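/- Let $\mathbb{T}=\mathbb{R}/2\pi\mathbb{Z}$ with normalized Lebesgue measure $dx/2\pi$, let $L^2_+$ be the space of $u\in L^2(\mathbb{T})$ with $\hat u(n)=0$ for all $n<0$, and let $\Pi$ be the orthogonal projection of $L^2(\mathbb{T})$ onto $L^2_+$. An element $u\in L^2_+$ is identified with the holomorphic function $u(z)=\sum_{k\ge 0}\hat u(k)z^k$ on the open unit disc $\mathbb{D}$. Let $BMO_+=BMO(\mathbb{T})\cap L^2_+$, where $BMO(\mathbb{T})$ is the space of functions of bounded mean oscillation. A solution in $BMO_+$ of the quadratic Szegő equation $$i\partial_t u=2J(u)\,\Pi(|u|^2)+\overline{J(u)}\,u^2,\qquad J(u)=\int_{\mathbb{T}}|u|^2u\,\frac{dx}{2\pi},$$ is a map $u:\mathbb{R}\to BMO_+$, bounded in $BMO$ on bounded time intervals and differentiable with values in $L^2(\mathbb{T})$, that satisfies the equation in $L^2(\mathbb{T})$ at every time. An inner function is an element $f\in L^2_+$ such that $|f(e^{ix})|=1$ for almost every $x\in\mathbb{T}$. Let $f$ be an inner function, and let $t\mapsto u(t,z)$ be a solution in $BMO_+$ of the quadratic Szegő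 equation, starting from $u(0,z)=u_0(z)\in BMO_+$. Then $zf(z)\in\mathbb{D}$ for every $z\in\mathbb{D}$, the function $u_0(zf(z))$ belongs to $BMO_+$, and $$t\mapsto u(t,zf(z))$$ is the solution in $BMO_+$ of the quadratic Szegő equation starting from the initial datum $u_0(zf(z))$: it is a solution with this initial datum, and it is the only one. -/

import Mathlib

open MeasureTheory AddCircle
open scoped Real ComplexConjugate

noncomputable section

namespace QuadSzego

/-- The circle `ℝ / 2πℤ`; the point `x` stands for `e^{ix}`. -/
abbrev Torus : Type := AddCircle (2 * π)

instance : Fact (0 < 2 * π) := ⟨Real.two_pi_pos⟩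

/-- The normalized Lebesgue measure `dx / 2π` on the circle. -/
abbrev mu : Measure Torus := haarAddCircle

/-- The space `L²` of the circle, for the normalized Lebesgue measure. -/
abbrev L2 : Type := Lp ℂ 2 mu

/-- The Hardy space `L²₊`: the elements of `L²` that are orthogonal to `e^{inx}` for all `n < 0`. -/
def hardySpace : Submodule ℂ L2 :=
  (Submodule.span ℂ {e : L2 | ∃ n : ℤ, n < 0 ∧ e = fourierLp 2 n})ᗮ

/-- The Szegő projector `Π`: the orthogonal projection of `L²` onto the Hardy space. -/
def szego : L2 →L[ℂ] L2 :=
  haveI : hardySpace.HasOrthogonalProjection := by unfold hardySpace; infer_instance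
  hardySpace.starProjection

theorem inner_fourierLp (n : ℤ) (u : L2) :
    inner ℂ (fourierLp (T := 2 * π) 2 n) u = fourierCoeff u n := by
  rw [← fourierBasis_repr, fourierBasis.repr_apply_apply, coe_fourierBasis]

/-- Elements of the Hardy space are the Fourier series with nonnegative modes only. -/
theorem mem_hardySpace_iff (u : L2) :
    u ∈ hardySpace ↔ ∀ n : ℤ, n < 0 → fourierCoeff u n = 0 := by
  constructor
  · intro h n hn
    rw [← inner_fourierLp]
    exact h _ (Submodule.subset_span ⟨n, hn, rfl⟩)
  · intro h
    rw [hardySpace, Submodule.mem_orthogonal]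
    intro e he
    induction he using Submodule.span_induction with
    | mem e he =>
      obtain ⟨n, hn, rfl⟩ := he
      rw [inner_fourierLp, h n hn]
    | zero => simp
    | add a b _ _ ha hb => rw [inner_add_left, ha, hb, add_zero]
    | smul c a _ ha => rw [inner_smul_left, ha, mul_zero]

/-- `Π (∑ u_n e^{inx}) = ∑_{n ≥ 0} u_n e^{inx}`. -/
theorem fourierCoeff_szego (u : L2) (n : ℤ) :
    fourierCoeff (szego u) n = if 0 ≤ n then fourierCoeff u n else 0 := by
  have : hardySpace.HasOrthogonalProjection := by unfold hardySpace; infer_instance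
  have hmem : szego u ∈ hardySpace := Submodule.starProjection_apply_mem _ u
  split_ifs with hn
  · have hf : (fourierLp (T := 2 * π) 2 n : L2) ∈ hardySpace := by
      rw [mem_hardySpace_iff]
      intro m hm
      rw [← inner_fourierLp]
      exact orthonormal_fourier.2 (by omega)
    have h0 : u - szego u ∈ hardySpaceᗮ := Submodule.sub_starProjection_mem_orthogonal u
    have h1 := h0 _ hf
    rw [inner_sub_right, inner_fourierLp, inner_fourierLp, sub_eq_zero] at h1
    exact h1.symm
  · exact (mem_hardySpace_iff _).1 hmem n (by omega)

/-- The mean oscillation of `u` is at most `C` on every arc of the circle. Arcs are the images of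
the intervals `(a, b]` with `0 < b - a ≤ 2π`, and `⨍` is the average. -/
def MeanOscLE (u : Torus → ℂ) (C : ℝ) : Prop :=
  ∀ a b : ℝ, a < b → b - a ≤ 2 * π →
    ⨍ x in a..b, ‖u (x : Torus) - ⨍ y in a..b, u (y : Torus)‖ ≤ C

/-- Functions of bounded mean oscillation on the circle. -/
def IsBMO (u : Torus → ℂ) : Prop :=
  Integrable u mu ∧ ∃ C : ℝ, MeanOscLE u C

/-- `BMO₊ = BMO ∩ L²₊`. -/
def BMOplus : Set L2 := {u | u ∈ hardySpace ∧ IsBMO u}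

/-- `J(u) = ∫ |u|² u`. -/
def J (u : L2) : ℂ := ∫ x, (‖u x‖ : ℂ) ^ 2 * u x ∂mu

/-- `u : ℝ → BMO₊` is a (global) solution of the quadratic Szegő equation
`i ∂ₜ u = 2 J(u) Π(|u|²) + conj (J(u)) u²` in `BMO₊`: it takes its values in `BMO₊`, it is bounded
in `BMO` on bounded time intervals, `|u(t)|²` and `u(t)²` are in `L²`, and `u` is differentiable in
time with values in `L²` and satisfies the equation in `L²` at every time. -/
structure IsSolution (u : ℝ → L2) : Prop where
  mem_BMOplus : ∀ t, u t ∈ BMOplus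
  locally_bounded : ∀ R : ℝ, ∃ C : ℝ, ∀ t : ℝ, |t| ≤ R → MeanOscLE (u t) C
  equation : ∀ t, ∃ p q u' : L2,
    (∀ᵐ x ∂mu, p x = (‖u t x‖ : ℂ) ^ 2) ∧
    (∀ᵐ x ∂mu, q x = (u t x) ^ 2) ∧
    HasDerivAt u u' t ∧
    Complex.I • u' = (2 * J (u t)) • szego p + conj (J (u t)) • q

/-- Inner functions: elements of `L²₊` of modulus one almost everywhere on the circle. -/
def IsInner (f : L2) : Prop :=
  f ∈ hardySpace ∧ ∀ᵐ x ∂mu, ‖f x‖ = 1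

/-- The holomorphic function `z ↦ ∑_{k ≥ 0} û(k) z^k` on the unit disc that an element `u` of the
Hardy space stands for. -/
def discFun (u : L2) (z : ℂ) : ℂ := ∑' k : ℕ, fourierCoeff u (k : ℤ) * z ^ k

end QuadSzego

end

noncomputable section

namespace QuadSzego

open Filter Topology Set

/-! The boundary values of `z f(z)` define a map φ of the circle (`innerMap`), and composition with
φ is a symmetry of every ingredient of the equation. For `|z| < 1`, φ pushes the Poisson measure at
`z` forward to the Poisson measure at `z f(z)` (`IsInner.map_poissonMeasure`), because the powers of
`z f(z)` are analytic and the Poisson integral is multiplicative on analytic functions. At `z = 0`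
this says that φ preserves `mu`, so `u ↦ u ∘ φ` is an isometry of `L²` that leaves `J` unchanged; it
obviously commutes with `|u|²` and `u²`. It commutes with `Π` because the extra factor `z` makes φ
send positive modes to positive modes and negative ones to negative ones (`compInner_szego`). It
preserves `BMO` because bounded mean oscillation is equivalent to a uniform bound on the Poisson
averages of `|u - c|`, with `c` depending on the point of the disc, and these averages are just
moved from `z f(z)` to `z` (`meanOscLE_compInner`). Hence solutions go to solutions
(`IsSolution.compInner`).

Uniqueness is an argument of Yudovich type. The vector field is not Lipschitz in `L²`, but
John–Nirenberg gives exponential integrability of both solutions, so cutting at height `N` bounds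
the derivative of their difference `d` by `A N ‖d‖ + A' exp(-cN)` for every `N ≥ 1`. Gronwall and `N
→ ∞` give `d = 0` for a short time, and connectedness of the line does the rest
(`IsSolution.unique`). -/

/-! ### The John–Nirenberg inequality on intervals -/

section JohnNirenberg

variable {g : ℝ → ℂ} {L C : ℝ}

/-- The mean of `g` over `(a, b]`. -/
def mean (g : ℝ → ℂ) (a b : ℝ) : ℂ := ⨍ x in a..b, g x

theorem mean_eq (g : ℝ → ℂ) (a b : ℝ) : mean g a b = (b - a)⁻¹ • ∫ x in a..b, g x :=
  interval_average_eq g a b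

theorem intervalIntegrable_norm_sub (hg : LocallyIntegrable g volume) (c : ℂ) (a b : ℝ) :
    IntervalIntegrable (fun x => ‖g x - c‖) volume a b :=
  ((hg.integrableOn_isCompact isCompact_uIcc).intervalIntegrable.sub
    (intervalIntegrable_const)).norm

theorem norm_mean_sub_mul_le (hg : LocallyIntegrable g volume) (c : ℂ) {a b : ℝ} (hab : a < b) :
    ‖mean g a b - c‖ * (b - a) ≤ ∫ x in a..b, ‖g x - c‖ := by
  have hg' : IntervalIntegrable g volume a b :=
    (hg.integrableOn_isCompact isCompact_uIcc).intervalIntegrable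
  have h : (b - a) • (mean g a b - c) = ∫ x in a..b, (g x - c) := by
    rw [intervalIntegral.integral_sub hg' intervalIntegrable_const, mean_eq, smul_sub, smul_smul,
      mul_inv_cancel₀ (sub_pos.2 hab).ne', one_smul, intervalIntegral.integral_const]
  calc ‖mean g a b - c‖ * (b - a) = ‖(b - a) • (mean g a b - c)‖ := by
        rw [norm_smul, Real.norm_of_nonneg (sub_pos.2 hab).le, mul_comm]
    _ ≤ _ := by rw [h]; exact intervalIntegral.norm_integral_le_integral_norm hab.le

/-- Mean oscillation at most `C` on the intervals of length at most `L`. -/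
def OscLE (g : ℝ → ℂ) (L C : ℝ) : Prop :=
  ∀ a b : ℝ, a < b → b - a ≤ L → ∫ x in a..b, ‖g x - mean g a b‖ ≤ C * (b - a)

/-- The oscillation integral over the large interval dominates the one over the half, and halving
the length doubles the average. -/
theorem norm_mean_sub_mean_le (hg : LocallyIntegrable g volume) (h : OscLE g L C)
    {a b a' b' : ℝ} (haa : a ≤ a') (hab : a' < b') (hbb : b' ≤ b) (hL : b - a ≤ L)
    (hlen : b - a = 2 * (b' - a')) : ‖mean g a' b' - mean g a b‖ ≤ 2 * C := by
  have h1 := norm_mean_sub_mul_le hg (mean g a b) hab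
  have h2 : ∫ x in a'..b', ‖g x - mean g a b‖ ≤ ∫ x in a..b, ‖g x - mean g a b‖ :=
    intervalIntegral.integral_mono_interval haa hab.le hbb
      (Eventually.of_forall fun _ => norm_nonneg _) (intervalIntegrable_norm_sub hg _ _ _)
  have h3 := h a b (by linarith) hL
  rw [hlen] at h3
  have : 0 < b' - a' := sub_pos.2 hab
  nlinarith

/-- The integral of `exp (l ‖G - c‖)` over `(a, b]`, where `G` is the mean of `g` over the dyadic
subintervals of generation `n`. -/
def dyadicSum (g : ℝ → ℂ) (l : ℝ) (c : ℂ) : ℕ → ℝ → ℝ → ℝ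
  | 0, a, b => (b - a) * Real.exp (l * ‖mean g a b - c‖)
  | n + 1, a, b => dyadicSum g l c n a ((a + b) / 2) + dyadicSum g l c n ((a + b) / 2) b

theorem dyadicSum_le_mul {l : ℝ} (hl : 0 ≤ l) (c c' : ℂ) (n : ℕ) :
    ∀ a b : ℝ, a < b →
      dyadicSum g l c n a b ≤ Real.exp (l * ‖c' - c‖) * dyadicSum g l c' n a b := by
  induction n with
  | zero =>
    intro a b hab
    have : l * ‖mean g a b - c‖ ≤ l * ‖c' - c‖ + l * ‖mean g a b - c'‖ := by
      rw [← mul_add, add_comm]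
      exact mul_le_mul_of_nonneg_left (norm_sub_le_norm_sub_add_norm_sub _ _ _) hl
    have h2 := Real.exp_le_exp.2 this
    rw [Real.exp_add] at h2
    have h3 := mul_le_mul_of_nonneg_left h2 (sub_pos.2 hab).le
    simp only [dyadicSum]
    linarith
  | succ n ih =>
    intro a b hab
    simp only [dyadicSum, mul_add]
    exact add_le_add (ih _ _ (by linarith)) (ih _ _ (by linarith))

theorem dyadicSum_nonneg (g : ℝ → ℂ) (l : ℝ) (c : ℂ) (n : ℕ) (a b : ℝ) (hab : a < b) :
    0 ≤ dyadicSum g l c n a b := by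
  induction n generalizing a b with
  | zero =>
    simp only [dyadicSum]
    have := sub_pos.2 hab
    positivity
  | succ n ih => exact add_nonneg (ih _ _ (by linarith)) (ih _ _ (by linarith))

/-- The stopped intervals of the stopping-time argument. Recentring at the mean of the interval
costs `exp(6lC)`, and since that mean is at least `4C` away from `c`, Chebyshev bounds the length by
the integral of `‖g - c‖`. -/
theorem dyadicSum_le_of_le_norm (hg : LocallyIntegrable g volume) (hC : 0 < C)
    {l M : ℝ} (hl : 0 ≤ l) (hM : 0 ≤ M) (n : ℕ) (c : ℂ) (a b : ℝ) (hab : a < b)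
    (h0 : dyadicSum g l (mean g a b) n a b ≤ M * (b - a))
    (hc : ‖mean g a b - c‖ ≤ 6 * C) (hbig : 4 * C ≤ ‖mean g a b - c‖) :
    dyadicSum g l c n a b ≤
      Real.exp (l * (6 * C)) * (M / (4 * C)) * ∫ x in a..b, ‖g x - c‖ := by
  have h2 : Real.exp (l * ‖mean g a b - c‖) ≤ Real.exp (l * (6 * C)) :=
    Real.exp_le_exp.2 (mul_le_mul_of_nonneg_left hc hl)
  have h3 : 4 * C * (b - a) ≤ ∫ x in a..b, ‖g x - c‖ :=
    (mul_le_mul_of_nonneg_right hbig (sub_pos.2 hab).le).trans (norm_mean_sub_mul_le hg c hab)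
  calc _ ≤ _ := dyadicSum_le_mul hl c (mean g a b) n a b hab
    _ ≤ Real.exp (l * (6 * C)) * (M * (b - a)) :=
      mul_le_mul h2 h0 (dyadicSum_nonneg _ _ _ _ _ _ hab) (Real.exp_pos _).le
    _ = Real.exp (l * (6 * C)) * (M / (4 * C)) * (4 * C * (b - a)) := by field_simp
    _ ≤ _ := by gcongr

/-- Stop at the first dyadic intervals whose mean is at distance at least `4C` from `c`. A parent
that was not stopped is within `4C` and one halving moves the mean by at most `2C`, whence the `6C`.
Intervals never stopped contribute the first term, stopped ones the second. A stopped interval may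
have any number of generations left, so the bound is assumed for all `m ≤ n`. -/
theorem dyadicSum_le_of_forall (hg : LocallyIntegrable g volume) (hC : 0 < C) (h : OscLE g L C)
    {l M : ℝ} (hl : 0 ≤ l) (hM : 0 ≤ M) (n : ℕ)
    (ih : ∀ m ≤ n, ∀ a b : ℝ, a < b → b - a ≤ L → dyadicSum g l (mean g a b) m a b ≤ M * (b - a))
    (c : ℂ) (a b : ℝ) (hab : a < b) (hL : b - a ≤ L) (hc : ‖mean g a b - c‖ ≤ 6 * C) :
    dyadicSum g l c n a b ≤ Real.exp (l * (4 * C)) * (b - a) +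
      Real.exp (l * (6 * C)) * (M / (4 * C)) * ∫ x in a..b, ‖g x - c‖ := by
  have hba := sub_pos.2 hab
  by_cases hbig : 4 * C ≤ ‖mean g a b - c‖
  · have h1 := dyadicSum_le_of_le_norm hg hC hl hM n c a b hab (ih n le_rfl a b hab hL) hc hbig
    have h2 := mul_nonneg (Real.exp_pos (l * (4 * C))).le hba.le
    linarith
  have hsmall := (not_le.1 hbig).le
  induction n generalizing a b with
  | zero =>
    have h1 : Real.exp (l * ‖mean g a b - c‖) ≤ Real.exp (l * (4 * C)) :=
      Real.exp_le_exp.2 (mul_le_mul_of_nonneg_left hsmall hl)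
    have h2 : 0 ≤ Real.exp (l * (6 * C)) * (M / (4 * C)) * ∫ x in a..b, ‖g x - c‖ :=
      mul_nonneg (by positivity) (intervalIntegral.integral_nonneg hab.le fun _ _ => norm_nonneg _)
    have h3 := mul_le_mul_of_nonneg_left h1 hba.le
    simp only [dyadicSum]
    linarith
  | succ n ihn =>
    have hchild : ∀ a' b', a ≤ a' → a' < b' → b' ≤ b → b - a = 2 * (b' - a') →
        dyadicSum g l c n a' b' ≤ Real.exp (l * (4 * C)) * (b' - a') +
          Real.exp (l * (6 * C)) * (M / (4 * C)) * ∫ x in a'..b', ‖g x - c‖ := by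
      intro a' b' haa hab' hbb hlen
      have h1 := norm_mean_sub_mean_le hg h haa hab' hbb hL hlen
      have h2 := norm_sub_le_norm_sub_add_norm_sub (mean g a' b') (mean g a b) c
      have hc' : ‖mean g a' b' - c‖ ≤ 6 * C := by linarith
      have ih' : ∀ m ≤ n, ∀ a b : ℝ, a < b → b - a ≤ L →
          dyadicSum g l (mean g a b) m a b ≤ M * (b - a) := fun m hm => ih m (by omega)
      by_cases hbig' : 4 * C ≤ ‖mean g a' b' - c‖
      · have h3 := dyadicSum_le_of_le_norm hg hC hl hM n c a' b' hab'
          (ih' n le_rfl a' b' hab' (by linarith)) hc' hbig'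
        have h4 := mul_nonneg (Real.exp_pos (l * (4 * C))).le (sub_pos.2 hab').le
        linarith
      · exact ihn ih' a' b' hab' (by linarith) hc' (sub_pos.2 hab') hbig' (not_le.1 hbig').le
    have i1 := hchild a ((a + b) / 2) le_rfl (by linarith) (by linarith) (by ring)
    have i2 := hchild ((a + b) / 2) b (by linarith) (by linarith) le_rfl (by ring)
    rw [← intervalIntegral.integral_add_adjacent_intervals
      (intervalIntegrable_norm_sub hg c a ((a + b) / 2))
      (intervalIntegrable_norm_sub hg c ((a + b) / 2) b)]
    simp only [dyadicSum]
    linarith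

/-- With `l = 1/(10C)` and `M = 4` the stopping-time bound closes: `exp(2/5) ≤ 2` for the intervals
never stopped, and `exp(3/5) · M/4 ≤ 2` for the stopped ones. -/
theorem dyadicSum_mean_le (hg : LocallyIntegrable g volume) (hC : 0 < C) (h : OscLE g L C) (n : ℕ)
    (a b : ℝ) (hab : a < b) (hL : b - a ≤ L) :
    dyadicSum g (1 / (10 * C)) (mean g a b) n a b ≤ 4 * (b - a) := by
  have hl : 0 ≤ 1 / (10 * C) := by positivity
  have x4 : 1 / (10 * C) * (4 * C) = 2 / 5 := by field_simp; norm_num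
  have x6 : 1 / (10 * C) * (6 * C) = 3 / 5 := by field_simp; norm_num
  have l6 : Real.exp (3 / 5) ≤ 2 := by
    rw [← Real.exp_log (show (0 : ℝ) < 2 by norm_num)]
    exact Real.exp_le_exp.2 (by linarith [Real.log_two_gt_d9])
  have l4 : Real.exp (2 / 5) ≤ 2 := (Real.exp_le_exp.2 (by norm_num)).trans l6
  induction n using Nat.strong_induction_on generalizing a b with
  | _ n ih =>
    have hba := sub_pos.2 hab
    cases n with
    | zero => simp only [dyadicSum]; simp; linarith
    | succ n =>
      have ih' : ∀ m ≤ n, ∀ a b : ℝ, a < b → b - a ≤ L →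
          dyadicSum g (1 / (10 * C)) (mean g a b) m a b ≤ 4 * (b - a) :=
        fun m hm a b => ih m (by omega) a b
      have e1 := norm_mean_sub_mean_le hg h (a := a) (b := b) (a' := a) (b' := (a + b) / 2) le_rfl
          (by linarith) (by linarith) hL (by ring)
      have e2 := norm_mean_sub_mean_le hg h (a := a) (b := b) (a' := (a + b) / 2) (b' := b)
          (by linarith) (by linarith) le_rfl hL (by ring)
      have i1 := dyadicSum_le_of_forall hg hC h hl (by norm_num) n ih' (mean g a b)
        a ((a + b) / 2) (by linarith) (by linarith) (by linarith)
      have i2 := dyadicSum_le_of_forall hg hC h hl (by norm_num) n ih' (mean g a b)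
        ((a + b) / 2) b (by linarith) (by linarith) (by linarith)
      have hs := intervalIntegral.integral_add_adjacent_intervals
        (intervalIntegrable_norm_sub hg (mean g a b) a ((a + b) / 2))
        (intervalIntegrable_norm_sub hg (mean g a b) ((a + b) / 2) b)
      have ho := h a b hab hL
      rw [x4, x6] at i1 i2
      simp only [dyadicSum]
      have k1 : Real.exp (3 / 5) * (4 / (4 * C)) * (∫ x in a..b, ‖g x - mean g a b‖)
          ≤ 2 * (b - a) := by
        calc _ ≤ 2 * (4 / (4 * C)) * (C * (b - a)) := by
              refine mul_le_mul (by gcongr) ho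
                (intervalIntegral.integral_nonneg hab.le fun _ _ => norm_nonneg _) (by positivity)
          _ = 2 * (b - a) := by field_simp
      rw [← hs, mul_add] at k1
      have k2 := mul_le_mul_of_nonneg_right l4 hba.le
      linarith

/-- The mean of `g` over the dyadic subinterval of `(a, b]` of generation `n` that contains `x`. -/
def dyadicMean (g : ℝ → ℂ) : ℕ → ℝ → ℝ → ℝ → ℂ
  | 0, a, b, _ => mean g a b
  | n + 1, a, b, x =>
    if x ≤ (a + b) / 2 then dyadicMean g n a ((a + b) / 2) x else dyadicMean g n ((a + b) / 2) b x

theorem measurable_dyadicMean (g : ℝ → ℂ) (n : ℕ) (a b : ℝ) : Measurable (dyadicMean g n a b) := by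
  induction n generalizing a b with
  | zero => exact measurable_const
  | succ n ih => exact Measurable.ite measurableSet_Iic (ih _ _) (ih _ _)

theorem lintegral_dyadicMean (g : ℝ → ℂ) (l : ℝ) (c : ℂ) (n : ℕ) (a b : ℝ) (hab : a < b) :
    ∫⁻ x in Ioc a b, ENNReal.ofReal (Real.exp (l * ‖dyadicMean g n a b x - c‖)) =
      ENNReal.ofReal (dyadicSum g l c n a b) ∧ 0 ≤ dyadicSum g l c n a b := by
  induction n generalizing a b with
  | zero =>
    have := sub_pos.2 hab
    simp only [dyadicMean, dyadicSum]
    refine ⟨?_, by positivity⟩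
    rw [setLIntegral_const, Real.volume_Ioc, ← ENNReal.ofReal_mul (Real.exp_pos _).le, mul_comm]
  | succ n ih =>
    obtain ⟨i1, p1⟩ := ih a ((a + b) / 2) (by linarith)
    obtain ⟨i2, p2⟩ := ih ((a + b) / 2) b (by linarith)
    refine ⟨?_, add_nonneg p1 p2⟩
    simp only [dyadicSum]
    rw [ENNReal.ofReal_add p1 p2, ← i1, ← i2,
      ← Ioc_union_Ioc_eq_Ioc (show a ≤ (a + b) / 2 by linarith) (show (a + b) / 2 ≤ b by linarith),
      lintegral_union measurableSet_Ioc (Ioc_disjoint_Ioc_of_le le_rfl)]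
    congr 1
    · refine setLIntegral_congr_fun measurableSet_Ioc fun x hx => ?_
      simp only [dyadicMean, if_pos hx.2]
    · refine setLIntegral_congr_fun measurableSet_Ioc fun x hx => ?_
      simp only [dyadicMean, if_neg (not_le.2 hx.1)]

theorem exists_dyadicMean_eq (g : ℝ → ℂ) (n : ℕ) (a b x : ℝ) (hx : x ∈ Ioc a b) :
    ∃ a' b', x ∈ Ioc a' b' ∧ b' - a' = (b - a) / 2 ^ n ∧ dyadicMean g n a b x = mean g a' b' := by
  induction n generalizing a b with
  | zero => exact ⟨a, b, hx, by simp, rfl⟩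
  | succ n ih =>
    by_cases hm : x ≤ (a + b) / 2
    · obtain ⟨a', b', h1, h2, h3⟩ := ih a ((a + b) / 2) ⟨hx.1, hm⟩
      refine ⟨a', b', h1, ?_, ?_⟩
      · rw [h2, pow_succ]; field_simp; ring
      · simp only [dyadicMean, if_pos hm, h3]
    · obtain ⟨a', b', h1, h2, h3⟩ := ih ((a + b) / 2) b ⟨not_le.1 hm, hx.2⟩
      refine ⟨a', b', h1, ?_, ?_⟩
      · rw [h2, pow_succ]; field_simp; ring
      · simp only [dyadicMean, if_neg hm, h3]

theorem ae_tendsto_dyadicMean (hg : LocallyIntegrable g volume) (a b : ℝ) :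
    ∀ᵐ x, x ∈ Ioc a b → Tendsto (fun n => dyadicMean g n a b x) atTop (𝓝 (g x)) := by
  -- Lebesgue differentiation along balls that need not be centred at `x`; the constant `1` only
  -- asks that they contain it.
  filter_upwards [IsUnifLocDoublingMeasure.ae_tendsto_average (μ := volume) hg 1] with x hx hxab
  choose a' b' h1 h2 h3 using fun n => exists_dyadicMean_eq g n a b x hxab
  have hδ : Tendsto (fun n : ℕ => (b' n - a' n) / 2) atTop (𝓝[>] 0) := by
    rw [tendsto_nhdsWithin_iff]
    refine ⟨?_, Eventually.of_forall fun n => ?_⟩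
    · simp_rw [h2]
      have : Tendsto (fun n : ℕ => (b - a) / 2 * (1 / 2 : ℝ) ^ n) atTop (𝓝 ((b - a) / 2 * 0)) :=
        (tendsto_pow_atTop_nhds_zero_of_lt_one (by norm_num) (by norm_num)).const_mul _
      rw [mul_zero] at this
      refine this.congr fun n => ?_
      rw [div_pow, one_pow]; ring
    · have := (h1 n).1.trans_le (h1 n).2
      simpa using! this
  have hball : ∀ n,
      Metric.closedBall ((a' n + b' n) / 2) ((b' n - a' n) / 2) = Icc (a' n) (b' n) := by
    intro n
    rw [Real.closedBall_eq_Icc]; congr 1 <;> ring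
  have := hx (fun n => (a' n + b' n) / 2) (fun n => (b' n - a' n) / 2) hδ
    (Eventually.of_forall fun n => by
      rw [one_mul, hball]; exact Ioc_subset_Icc_self (h1 n))
  refine this.congr fun n => ?_
  rw [h3 n, hball, mean, uIoc_of_le ((h1 n).1.trans_le (h1 n).2).le]
  exact setAverage_congr Ioc_ae_eq_Icc.symm

/-- The John–Nirenberg inequality. -/
theorem lintegral_exp_norm_sub_mean_le (hg : LocallyIntegrable g volume) (hC : 0 < C)
    (h : OscLE g L C) {a b : ℝ} (hab : a < b) (hL : b - a ≤ L) :
    ∫⁻ x in Ioc a b, ENNReal.ofReal (Real.exp (1 / (10 * C) * ‖g x - mean g a b‖)) ≤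
      ENNReal.ofReal (4 * (b - a)) := by
  have hlim : ∀ᵐ x ∂(volume.restrict (Ioc a b)), Tendsto (fun n => ENNReal.ofReal
      (Real.exp (1 / (10 * C) * ‖dyadicMean g n a b x - mean g a b‖))) atTop
      (𝓝 (ENNReal.ofReal (Real.exp (1 / (10 * C) * ‖g x - mean g a b‖)))) := by
    rw [ae_restrict_iff' measurableSet_Ioc]
    filter_upwards [ae_tendsto_dyadicMean hg a b] with x hx hxab
    have hc : Continuous fun w : ℂ =>
        ENNReal.ofReal (Real.exp (1 / (10 * C) * ‖w - mean g a b‖)) :=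
      ENNReal.continuous_ofReal.comp (by fun_prop)
    exact (hc.tendsto _).comp (hx hxab)
  -- Fatou's lemma turns the bound uniform in the generation into one for `g` itself.
  calc _ = ∫⁻ x in Ioc a b, liminf (fun n => ENNReal.ofReal
      (Real.exp (1 / (10 * C) * ‖dyadicMean g n a b x - mean g a b‖))) atTop :=
        lintegral_congr_ae (hlim.mono fun x hx => hx.liminf_eq.symm)
    _ ≤ liminf (fun n => ∫⁻ x in Ioc a b, ENNReal.ofReal
      (Real.exp (1 / (10 * C) * ‖dyadicMean g n a b x - mean g a b‖))) atTop := by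
        refine lintegral_liminf_le fun n => ?_
        have := measurable_dyadicMean g n a b
        fun_prop
    _ ≤ _ := by
        refine liminf_le_of_frequently_le' (Frequently.of_forall fun n => ?_)
        rw [(lintegral_dyadicMean g _ _ n a b hab).1]
        exact ENNReal.ofReal_le_ofReal (dyadicSum_mean_le hg hC h n a b hab hL)

end JohnNirenberg

/-! ### Mean oscillation and Poisson averages -/

section Poisson

theorem integral_mu_eq (g : Torus → ℝ) (θ : ℝ) :
    ∫ x, g x ∂mu = (2 * π)⁻¹ * ∫ x in (θ - π)..(θ + π), g x := by
  have h := AddCircle.intervalIntegral_preimage (2 * π) (θ - π) g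
  rw [show θ - π + 2 * π = θ + π by ring] at h
  rw [h, AddCircle.integral_haarAddCircle, smul_eq_mul]

theorem integrable_volume_of_mu {E : Type*} [NormedAddCommGroup E] {g : Torus → E}
    (hg : Integrable g mu) : Integrable g volume := by
  rw [AddCircle.volume_eq_smul_haarAddCircle]
  exact hg.smul_measure ENNReal.ofReal_ne_top

theorem locallyIntegrable_lift {E : Type*} [NormedAddCommGroup E] {g : Torus → E}
    (hg : Integrable g mu) : LocallyIntegrable (fun x : ℝ => g x) volume := by
  have hper : Function.Periodic (fun x : ℝ => g x) (2 * π) := fun x => by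
    simp only [AddCircle.coe_add_period]
  have h1 : IntegrableOn (fun x : ℝ => g x) (Ioc 0 (0 + 2 * π)) volume :=
    (AddCircle.measurePreserving_mk (2 * π) 0).integrable_comp_of_integrable
      (integrable_volume_of_mu hg)
  have h2 : IntervalIntegrable (fun x : ℝ => g x) volume 0 (0 + 2 * π) :=
    (intervalIntegrable_iff_integrableOn_Ioc_of_le (by linarith [Real.two_pi_pos])).2 h1
  refine fun x => ⟨Ioc (x - 1) (x + 1),
    Ioc_mem_nhds (by linarith) (by linarith), ?_⟩
  exact (intervalIntegrable_iff_integrableOn_Ioc_of_le (by linarith)).1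
    (hper.intervalIntegrable Real.two_pi_pos.ne' h2 _ _)

theorem meanOscLE_iff (u : Torus → ℂ) (C : ℝ) :
    MeanOscLE u C ↔ OscLE (fun x : ℝ => u x) (2 * π) C := by
  refine forall₄_congr fun a b hab _ => ?_
  rw [interval_average_eq, smul_eq_mul, inv_mul_le_iff₀ (sub_pos.2 hab), mul_comm (b - a)]
  rfl

theorem MeanOscLE.nonneg {u : Torus → ℂ} {C : ℝ} (h : MeanOscLE u C) : 0 ≤ C := by
  refine le_trans ?_ (h 0 1 one_pos (by linarith [Real.pi_gt_three]))
  rw [interval_average_eq, smul_eq_mul]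
  have := intervalIntegral.integral_nonneg (μ := volume) (zero_le_one' ℝ)
    (fun x _ => norm_nonneg (u (x : Torus) - ⨍ y in (0 : ℝ)..1, u (y : Torus)))
  positivity

theorem MeanOscLE.mono {u : Torus → ℂ} {C C' : ℝ} (h : MeanOscLE u C) (hC : C ≤ C') :
    MeanOscLE u C' :=
  fun a b hab hL => (h a b hab hL).trans hC

/-! ### The Poisson kernel and its comparison with averages over arcs. -/

/-- The Poisson kernel of the unit disc. -/
def poisson (z : ℂ) (x : Torus) : ℝ := (1 - ‖z‖ ^ 2) / ‖fourier 1 x - z‖ ^ 2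

theorem norm_fourier_apply (n : ℤ) (x : Torus) : ‖fourier n x‖ = 1 := by
  rw [fourier_apply]; exact Circle.norm_coe _

theorem fourier_sub_ne_zero {z : ℂ} (hz : ‖z‖ < 1) (x : Torus) : fourier 1 x - z ≠ 0 := by
  intro h
  rw [sub_eq_zero] at h
  rw [← h, norm_fourier_apply] at hz
  exact lt_irrefl _ hz

theorem continuous_poisson {z : ℂ} (hz : ‖z‖ < 1) : Continuous (poisson z) := by
  unfold poisson
  refine continuous_const.div (by fun_prop) fun x => ?_
  exact pow_ne_zero _ (norm_ne_zero_iff.2 (fourier_sub_ne_zero hz x))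

theorem poisson_nonneg {z : ℂ} (hz : ‖z‖ < 1) (x : Torus) : 0 ≤ poisson z x := by
  refine div_nonneg ?_ (by positivity)
  nlinarith [norm_nonneg z]

theorem fourier_one_coe (x : ℝ) : fourier 1 (x : Torus) = Complex.exp (Complex.I * x) := by
  rw [fourier_coe_apply]
  congr 1
  have : (π : ℂ) ≠ 0 := Complex.ofReal_ne_zero.2 Real.pi_ne_zero
  push_cast
  field_simp

theorem norm_exp_sub_exp (x θ : ℝ) :
    ‖Complex.exp (Complex.I * x) - Complex.exp (Complex.I * θ)‖ = 2 * |Real.sin ((x - θ) / 2)| := by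
  have h : Complex.exp (Complex.I * x) - Complex.exp (Complex.I * θ) =
      Complex.exp (Complex.I * θ) * (Complex.exp (Complex.I * ((x - θ : ℝ) : ℂ)) - 1) := by
    rw [mul_sub, ← Complex.exp_add, mul_one]
    congr 2
    push_cast; ring
  rw [h, norm_mul, Complex.norm_exp_I_mul_ofReal, one_mul, Complex.norm_exp_I_mul_ofReal_sub_one,
    norm_mul, Real.norm_eq_abs, Real.norm_eq_abs, abs_two]

theorem norm_exp_sub_polar_ge {r : ℝ} (h0 : 0 ≤ r) (x θ : ℝ) :
    1 - r ≤ ‖Complex.exp (Complex.I * x) - r * Complex.exp (Complex.I * θ)‖ := by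
  have := norm_sub_norm_le (Complex.exp (Complex.I * x)) (r * Complex.exp (Complex.I * θ))
  rw [norm_mul, Complex.norm_exp_I_mul_ofReal, Complex.norm_exp_I_mul_ofReal, mul_one,
    Complex.norm_of_nonneg h0] at this
  exact this

theorem norm_exp_sub_polar {r : ℝ} (h1 : r ≤ 1) (θ : ℝ) :
    ‖Complex.exp (Complex.I * θ) - r * Complex.exp (Complex.I * θ)‖ = 1 - r := by
  have : Complex.exp (Complex.I * θ) - r * Complex.exp (Complex.I * θ) =
    ((1 - r : ℝ) : ℂ) * Complex.exp (Complex.I * θ) := by push_cast; ring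
  rw [this, norm_mul, Complex.norm_exp_I_mul_ofReal, mul_one,
    Complex.norm_of_nonneg (sub_nonneg.2 h1)]

theorem norm_exp_sub_polar_ge_abs {r : ℝ} (h0 : 0 ≤ r) (h1 : r ≤ 1) {x θ : ℝ} (hx : |x - θ| ≤ π) :
    |x - θ| / π ≤ ‖Complex.exp (Complex.I * x) - r * Complex.exp (Complex.I * θ)‖ := by
  have e1 := norm_exp_sub_exp x θ
  have e2 := norm_sub_le_norm_sub_add_norm_sub (Complex.exp (Complex.I * x))
    (r * Complex.exp (Complex.I * θ)) (Complex.exp (Complex.I * θ))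
  rw [norm_sub_rev (r * Complex.exp (Complex.I * θ)), norm_exp_sub_polar h1] at e2
  have e3 := norm_exp_sub_polar_ge h0 x θ
  have e4 : 2 / π * |(x - θ) / 2| ≤ |Real.sin ((x - θ) / 2)| := by
    refine Real.mul_abs_le_abs_sin ?_
    rw [abs_div, abs_two]; linarith
  rw [abs_div, abs_two] at e4
  have e5 : 2 / π * (|x - θ| / 2) = |x - θ| / π := by ring
  linarith

theorem norm_exp_sub_polar_le {r : ℝ} (h1 : r ≤ 1) (x θ : ℝ) :
    ‖Complex.exp (Complex.I * x) - r * Complex.exp (Complex.I * θ)‖ ≤ |x - θ| + (1 - r) := by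
  have e1 := norm_exp_sub_exp x θ
  have e2 := norm_sub_le_norm_sub_add_norm_sub (Complex.exp (Complex.I * x))
    (Complex.exp (Complex.I * θ)) (r * Complex.exp (Complex.I * θ))
  rw [norm_exp_sub_polar h1] at e2
  have e3 := Real.abs_sin_le_abs (x := (x - θ) / 2)
  rw [abs_div, abs_two] at e3
  linarith

/-- Each of the `j` doublings costs `2C`. The growth is only linear in `j`, which the decay of the
Poisson kernel absorbs. -/
theorem norm_mean_dyadic_sub_le {g : ℝ → ℂ} (hg : LocallyIntegrable g volume) {L C : ℝ}
    (h : OscLE g L C) (θ : ℝ) {ℓ : ℝ} (hℓ : 0 < ℓ) (j : ℕ) (hj : 2 * (2 ^ j * ℓ) ≤ L) :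
    ‖mean g (θ - 2 ^ j * ℓ) (θ + 2 ^ j * ℓ) - mean g (θ - ℓ) (θ + ℓ)‖ ≤ 2 * C * j := by
  induction j with
  | zero => simp
  | succ j ih =>
    have hp : 0 < 2 ^ j * ℓ := by positivity
    have e : (2 : ℝ) ^ (j + 1) * ℓ = 2 * (2 ^ j * ℓ) := by ring
    rw [e] at hj ⊢
    have h1 := ih (by linarith)
    have h2 := norm_mean_sub_mean_le hg h (a := θ - 2 * (2 ^ j * ℓ)) (b := θ + 2 * (2 ^ j * ℓ))
      (a' := θ - 2 ^ j * ℓ) (b' := θ + 2 ^ j * ℓ) (by linarith) (by linarith) (by linarith)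
      (by linarith) (by ring)
    rw [norm_sub_rev] at h2
    have h3 := norm_sub_le_norm_sub_add_norm_sub
      (mean g (θ - 2 * (2 ^ j * ℓ)) (θ + 2 * (2 ^ j * ℓ)))
      (mean g (θ - 2 ^ j * ℓ) (θ + 2 ^ j * ℓ)) (mean g (θ - ℓ) (θ + ℓ))
    push_cast
    linarith

theorem integral_norm_sub_mean_dyadic_le {g : ℝ → ℂ} (hg : LocallyIntegrable g volume) {L C : ℝ}
    (h : OscLE g L C) (θ : ℝ) {ℓ : ℝ} (hℓ : 0 < ℓ) (j : ℕ) (hj : 2 * (2 ^ j * ℓ) ≤ L) :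
    ∫ x in (θ - 2 ^ j * ℓ)..(θ + 2 ^ j * ℓ), ‖g x - mean g (θ - ℓ) (θ + ℓ)‖ ≤
      C * (2 * j + 1) * (2 * (2 ^ j * ℓ)) := by
  have hp : 0 < 2 ^ j * ℓ := by positivity
  have h1 := h (θ - 2 ^ j * ℓ) (θ + 2 ^ j * ℓ) (by linarith) (by linarith)
  have h2 := norm_mean_dyadic_sub_le hg h θ hℓ j hj
  have h3 : ∫ x in (θ - 2 ^ j * ℓ)..(θ + 2 ^ j * ℓ), ‖g x - mean g (θ - ℓ) (θ + ℓ)‖ ≤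
      ∫ x in (θ - 2 ^ j * ℓ)..(θ + 2 ^ j * ℓ),
        (‖g x - mean g (θ - 2 ^ j * ℓ) (θ + 2 ^ j * ℓ)‖ + 2 * C * j) := by
    refine intervalIntegral.integral_mono_on (by linarith) (intervalIntegrable_norm_sub hg _ _ _)
      ((intervalIntegrable_norm_sub hg _ _ _).add intervalIntegrable_const) fun x _ => ?_
    exact (norm_sub_le_norm_sub_add_norm_sub _ _ _).trans (by gcongr)
  rw [intervalIntegral.integral_add (intervalIntegrable_norm_sub hg _ _ _)
    intervalIntegrable_const, intervalIntegral.integral_const, smul_eq_mul] at h3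
  linarith

/-- The central interval is handled by `P ≤ 2/δ`, the ring at distance `s` to `2s` by the quadratic
decay of `P`; the `j`-th ring contributes `16πC(2j+3)/2^(j+1)`. The right-hand side is the closed
form of the partial sums of this series, the central interval giving the value at `j = 0`. -/
theorem integral_weight_mul_le {g : ℝ → ℂ} (hg : LocallyIntegrable g volume) {C : ℝ} (hC : 0 ≤ C)
    (h : OscLE g (2 * π) C) (θ : ℝ) {δ : ℝ} (hδ : 0 < δ) (m : ℕ) (h1 : (1 / 2 : ℝ) ^ (m + 1) < δ)
    (h2 : δ ≤ (1 / 2 : ℝ) ^ m) {P : ℝ → ℝ} (hP : Continuous P) (hP0 : ∀ x, P x ≤ 2 / δ)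
    (hP1 : ∀ x, |x - θ| ≤ π → P x * |x - θ| ^ 2 ≤ 2 * π ^ 2 * δ) (j : ℕ) (hj : j ≤ m) :
    ∫ x in (θ - 2 ^ j * (π * (1 / 2) ^ m))..(θ + 2 ^ j * (π * (1 / 2) ^ m)),
        P x * ‖g x - mean g (θ - π * (1 / 2) ^ m) (θ + π * (1 / 2) ^ m)‖ ≤
      16 * π * C * (6 - (2 * j + 5) * (1 / 2) ^ j) := by
  have hπ := Real.pi_pos
  have hq : (0 : ℝ) < (1 / 2) ^ m := by positivity
  set ℓ := π * (1 / 2) ^ m with hℓ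
  have hℓ0 : 0 < ℓ := by positivity
  have hlen : ∀ j ≤ m, 2 * (2 ^ j * ℓ) ≤ 2 * π := by
    intro j hj
    have : (2 : ℝ) ^ j * (1 / 2) ^ m ≤ 1 := by
      calc (2 : ℝ) ^ j * (1 / 2) ^ m ≤ 2 ^ m * (1 / 2) ^ m := by gcongr; norm_num
        _ = 1 := by rw [← mul_pow]; norm_num
    rw [hℓ]; nlinarith
  set c := mean g (θ - ℓ) (θ + ℓ) with hc
  have hi : ∀ a b, IntervalIntegrable (fun x => ‖g x - c‖) volume a b :=
    intervalIntegrable_norm_sub hg c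
  have hPi : ∀ a b, IntervalIntegrable (fun x => P x * ‖g x - c‖) volume a b := fun a b =>
    (hi a b).continuousOn_mul hP.continuousOn
  induction j with
  | zero =>
    have e0 := integral_norm_sub_mean_dyadic_le hg h θ hℓ0 0 (hlen 0 (Nat.zero_le _))
    simp only [pow_zero, one_mul, Nat.cast_zero, mul_zero, zero_add, mul_one] at e0 ⊢
    have e1 : ∫ x in (θ - ℓ)..(θ + ℓ), P x * ‖g x - c‖ ≤
        ∫ x in (θ - ℓ)..(θ + ℓ), 2 / δ * ‖g x - c‖ :=
      intervalIntegral.integral_mono_on (by linarith) (hPi _ _) ((hi _ _).const_mul _)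
        fun x _ => by gcongr; exact hP0 x
    rw [intervalIntegral.integral_const_mul] at e1
    have e2 : 2 / δ * (∫ x in (θ - ℓ)..(θ + ℓ), ‖g x - c‖) ≤ 2 / δ * (C * (2 * ℓ)) := by gcongr
    have e3 : 2 / δ * (C * (2 * ℓ)) ≤ 16 * π * C := by
      rw [div_mul_eq_mul_div, div_le_iff₀ hδ, hℓ]
      have : (1 / 2 : ℝ) ^ m ≤ 2 * δ := by rw [pow_succ] at h1; linarith
      nlinarith [mul_nonneg hπ.le hC, mul_le_mul_of_nonneg_left this (mul_nonneg hπ.le hC)]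
    nlinarith
  | succ j ih =>
    have ih' := ih (by omega)
    have e0 := integral_norm_sub_mean_dyadic_le hg h θ hℓ0 (j + 1) (hlen _ hj)
    have hl := hlen _ hj
    have e : (2 : ℝ) ^ (j + 1) * ℓ = 2 * (2 ^ j * ℓ) := by ring
    rw [e] at e0 hl ⊢
    set s := 2 ^ j * ℓ with hs
    have hs0 : 0 < s := by positivity
    have hbd : ∀ x, s ≤ |x - θ| → |x - θ| ≤ 2 * s →
        P x * ‖g x - c‖ ≤ 2 * π ^ 2 * δ / s ^ 2 * ‖g x - c‖ := by
      intro x hx hx'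
      gcongr
      rw [le_div_iff₀ (by positivity)]
      by_cases hPx : 0 ≤ P x
      · refine le_trans ?_ (hP1 x (by linarith))
        gcongr
      · exact (mul_nonpos_of_nonpos_of_nonneg (not_le.1 hPx).le (by positivity)).trans
          (by positivity)
    have f1 : ∫ x in (θ - 2 * s)..(θ - s), P x * ‖g x - c‖ ≤
        ∫ x in (θ - 2 * s)..(θ - s), 2 * π ^ 2 * δ / s ^ 2 * ‖g x - c‖ := by
      refine intervalIntegral.integral_mono_on (by linarith) (hPi _ _) ((hi _ _).const_mul _)
        fun x hx => hbd x ?_ ?_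
      · rw [abs_of_nonpos (by linarith [hx.2])]; linarith [hx.2]
      · rw [abs_of_nonpos (by linarith [hx.2])]; linarith [hx.1]
    have f2 : ∫ x in (θ + s)..(θ + 2 * s), P x * ‖g x - c‖ ≤
        ∫ x in (θ + s)..(θ + 2 * s), 2 * π ^ 2 * δ / s ^ 2 * ‖g x - c‖ := by
      refine intervalIntegral.integral_mono_on (by linarith) (hPi _ _) ((hi _ _).const_mul _)
        fun x hx => hbd x ?_ ?_
      · rw [abs_of_nonneg (by linarith [hx.1])]; linarith [hx.1]
      · rw [abs_of_nonneg (by linarith [hx.1])]; linarith [hx.2]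
    rw [intervalIntegral.integral_const_mul] at f1 f2
    have s1 := intervalIntegral.integral_add_adjacent_intervals (hPi (θ - 2 * s) (θ - s))
      (hPi (θ - s) (θ + s))
    have s2 := intervalIntegral.integral_add_adjacent_intervals (hPi (θ - 2 * s) (θ + s))
      (hPi (θ + s) (θ + 2 * s))
    have t1 := intervalIntegral.integral_add_adjacent_intervals (hi (θ - 2 * s) (θ - s))
      (hi (θ - s) (θ + s))
    have t2 := intervalIntegral.integral_add_adjacent_intervals (hi (θ - 2 * s) (θ + s))
      (hi (θ + s) (θ + 2 * s))
    have t3 : 0 ≤ ∫ x in (θ - s)..(θ + s), ‖g x - c‖ :=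
      intervalIntegral.integral_nonneg (by linarith) fun _ _ => norm_nonneg _
    have k1 : (∫ x in (θ - 2 * s)..(θ - s), ‖g x - c‖) +
        (∫ x in (θ + s)..(θ + 2 * s), ‖g x - c‖) ≤
        C * (2 * ((j + 1 : ℕ) : ℝ) + 1) * (2 * (2 * s)) := by linarith
    have k2 := mul_le_mul_of_nonneg_left k1 (show 0 ≤ 2 * π ^ 2 * δ / s ^ 2 by positivity)
    have k3 : 2 * π ^ 2 * δ / s ^ 2 * (C * (2 * ((j + 1 : ℕ) : ℝ) + 1) * (2 * (2 * s))) ≤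
        16 * π * C * ((2 * j + 3) * (1 / 2) ^ (j + 1)) := by
      have g1 : 2 * π ^ 2 * δ / s ^ 2 * (C * (2 * ((j + 1 : ℕ) : ℝ) + 1) * (2 * (2 * s))) =
          8 * π ^ 2 * C * (2 * j + 3) * (δ / s) := by
        push_cast; field_simp; ring
      have g2 : δ / s ≤ (1 / 2) ^ j / π := by
        rw [div_le_div_iff₀ hs0 hπ, hs, hℓ]
        have : (1 / 2 : ℝ) ^ j * (2 ^ j * (π * (1 / 2) ^ m)) = (1 / 2) ^ m * π := by
          rw [← mul_assoc, ← mul_pow]; norm_num [mul_comm]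
        rw [this]; gcongr
      rw [g1]
      calc _ ≤ 8 * π ^ 2 * C * (2 * j + 3) * ((1 / 2) ^ j / π) := by gcongr
        _ = _ := by field_simp; ring
    have k4 : 16 * π * C * (6 - (2 * ((j + 1 : ℕ) : ℝ) + 5) * (1 / 2) ^ (j + 1)) =
        16 * π * C * (6 - (2 * j + 5) * (1 / 2) ^ j) +
          16 * π * C * ((2 * j + 3) * (1 / 2) ^ (j + 1)) := by
      push_cast; ring
    rw [k4]
    linarith

theorem exists_integral_poisson_mul_le {u : Torus → ℂ} (hu : Integrable u mu) {C : ℝ}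
    (h : MeanOscLE u C) {z : ℂ} (hz : ‖z‖ < 1) :
    ∃ c : ℂ, ∫ x, poisson z x * ‖u x - c‖ ∂mu ≤ 48 * C := by
  have hC := h.nonneg
  rw [meanOscLE_iff] at h
  have hπ := Real.pi_pos
  set r := ‖z‖ with hr
  have hr0 : 0 ≤ r := norm_nonneg z
  set θ := z.arg with hθ
  have hzr : z = r * Complex.exp (Complex.I * θ) := by
    rw [mul_comm Complex.I]; exact (Complex.norm_mul_exp_arg_mul_I z).symm
  have hδ : 0 < 1 - r := by linarith
  -- The dyadic scale comparable to `1 - ‖z‖`; `c` will be the mean over an arc of this scale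
  -- centred at the argument of `z`, and `m` doublings of that arc fill the circle.
  obtain ⟨m, h1, h2⟩ := exists_nat_pow_near_of_lt_one hδ (by linarith)
    (show (0 : ℝ) < 1 / 2 by norm_num) (by norm_num)
  have hform : ∀ x : ℝ, poisson z x =
      (1 - r ^ 2) / ‖Complex.exp (Complex.I * x) - r * Complex.exp (Complex.I * θ)‖ ^ 2 := by
    intro x
    rw [poisson, fourier_one_coe, ← hzr]
  have hnum : 1 - r ^ 2 ≤ 2 * (1 - r) := by nlinarith
  have hnum0 : 0 ≤ 1 - r ^ 2 := by nlinarith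
  have key := integral_weight_mul_le (locallyIntegrable_lift hu) hC h θ hδ m h1 h2
    (P := fun x : ℝ => poisson z x)
    ((continuous_poisson hz).comp (AddCircle.continuous_mk' _)) (fun x => by
      have e := norm_exp_sub_polar_ge hr0 x θ
      rw [hform]
      have e2 : (1 - r) ^ 2 ≤
        ‖Complex.exp (Complex.I * x) - r * Complex.exp (Complex.I * θ)‖ ^ 2 := by gcongr
      rw [div_le_div_iff₀ (by nlinarith) hδ]
      nlinarith) (fun x hx => by
      have e := norm_exp_sub_polar_ge_abs hr0 hz.le hx
      have e' := norm_exp_sub_polar_ge hr0 x θ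
      rw [hform]
      set D := ‖Complex.exp (Complex.I * x) - r * Complex.exp (Complex.I * θ)‖
      rw [div_le_iff₀ hπ] at e
      have e2 : |x - θ| ^ 2 ≤ (D * π) ^ 2 := by gcongr
      have hD : 0 < D := by linarith
      rw [div_mul_eq_mul_div, div_le_iff₀ (by positivity)]
      calc (1 - r ^ 2) * |x - θ| ^ 2 ≤ (2 * (1 - r)) * (D * π) ^ 2 := by gcongr
        _ = _ := by ring) m le_rfl
  have hfull : (2 : ℝ) ^ m * (π * (1 / 2) ^ m) = π := by
    rw [mul_left_comm, ← mul_pow]; norm_num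
  rw [hfull] at key
  refine ⟨mean (fun x : ℝ => u x) (θ - π * (1 / 2) ^ m) (θ + π * (1 / 2) ^ m), ?_⟩
  rw [integral_mu_eq _ θ, inv_mul_le_iff₀ (by positivity)]
  refine key.trans ?_
  have : 0 ≤ (2 * (m : ℝ) + 5) * (1 / 2) ^ m := by positivity
  nlinarith [mul_nonneg hπ.le hC, mul_nonneg (mul_nonneg hπ.le hC) this]

/-- To an arc of length `2πδ` corresponds the point of modulus `1 - δ` above its midpoint, whose
Poisson kernel is at least `1/((1+π)²δ)` on the arc. The factor `2` pays for replacing `c` by the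
mean. -/
theorem meanOscLE_of_integral_poisson_mul_le {u : Torus → ℂ} (hu : Integrable u mu) {K : ℝ}
    (h : ∀ z : ℂ, ‖z‖ < 1 → ∃ c : ℂ, ∫ x, poisson z x * ‖u x - c‖ ∂mu ≤ K) :
    MeanOscLE u (2 * (1 + π) ^ 2 * K) := by
  rw [meanOscLE_iff]
  intro a b hab hL
  have hπ := Real.pi_pos
  have hg := locallyIntegrable_lift hu
  set θ := (a + b) / 2 with hθ
  set δ := (b - a) / 2 / π with hδ
  have hba := sub_pos.2 hab
  have hδ0 : 0 < δ := by positivity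
  have hδ1 : δ ≤ 1 := by rw [hδ, div_le_one hπ]; linarith
  have hlen : b - a = 2 * π * δ := by rw [hδ]; field_simp
  set r := 1 - δ with hr
  have hr0 : 0 ≤ r := by linarith
  have hr1 : r ≤ 1 := by linarith
  have hzn : ‖(r : ℂ) * Complex.exp (Complex.I * θ)‖ = r := by
    rw [norm_mul, Complex.norm_exp_I_mul_ofReal, mul_one, Complex.norm_of_nonneg hr0]
  obtain ⟨c, hc⟩ := h (r * Complex.exp (Complex.I * θ)) (by rw [hzn]; linarith)
  set z := (r : ℂ) * Complex.exp (Complex.I * θ) with hz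
  have hz1 : ‖z‖ < 1 := by rw [hzn]; linarith
  have hPc : Continuous fun x : ℝ => poisson z x :=
    (continuous_poisson hz1).comp (AddCircle.continuous_mk' _)
  have hi : ∀ a b, IntervalIntegrable (fun x : ℝ => ‖u x - c‖) volume a b :=
    intervalIntegrable_norm_sub hg c
  have hPi : ∀ a b, IntervalIntegrable (fun x : ℝ => poisson z x * ‖u x - c‖) volume a b :=
    fun a b => (hi a b).continuousOn_mul hPc.continuousOn
  have hlow : ∀ x ∈ Icc a b, 1 ≤ (1 + π) ^ 2 * δ * poisson z x := by
    intro x hx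
    have hx' : |x - θ| ≤ π * δ := by
      rw [abs_le]; constructor <;> linarith [hx.1, hx.2]
    have e1 := norm_exp_sub_polar_le hr1 x θ
    have e2 := norm_exp_sub_polar_ge hr0 x θ
    rw [poisson, fourier_one_coe, hzn, ← mul_div_assoc,
      one_le_div (by have : 0 < 1 - r := by linarith
                     have := this.trans_le e2
                     positivity)]
    calc _ ≤ ((1 + π) * δ) ^ 2 := by gcongr; linarith
      _ = (1 + π) ^ 2 * δ * δ := by ring
      _ ≤ _ := by gcongr; rw [hr]; nlinarith
  have i1 : ∫ x in a..b, ‖u (x : Torus) - c‖ ≤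
      ∫ x in a..b, (1 + π) ^ 2 * δ * (poisson z x * ‖u x - c‖) := by
    refine intervalIntegral.integral_mono_on hab.le (hi _ _) ((hPi _ _).const_mul _) fun x hx => ?_
    rw [← mul_assoc]
    exact le_mul_of_one_le_left (norm_nonneg _) (hlow x hx)
  rw [intervalIntegral.integral_const_mul] at i1
  have i2 : ∫ x in a..b, poisson z x * ‖u (x : Torus) - c‖ ≤
      ∫ x in (θ - π)..(θ + π), poisson z x * ‖u (x : Torus) - c‖ :=
    intervalIntegral.integral_mono_interval (by linarith) hab.le (by linarith)
      (Eventually.of_forall fun x => mul_nonneg (poisson_nonneg hz1 _) (norm_nonneg _)) (hPi _ _)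
  rw [integral_mu_eq _ θ, inv_mul_le_iff₀ (by positivity)] at hc
  have i3 : ∫ x in a..b, ‖u (x : Torus) - c‖ ≤ (1 + π) ^ 2 * K * (b - a) := by
    calc _ ≤ (1 + π) ^ 2 * δ * (2 * π * K) := i1.trans (by gcongr; exact i2.trans hc)
      _ = _ := by rw [hlen]; ring
  have i4 := norm_mean_sub_mul_le hg c hab
  have i5 : ∫ x in a..b, ‖u (x : Torus) - mean (fun x : ℝ => u x) a b‖ ≤
      ∫ x in a..b, (‖u (x : Torus) - c‖ + ‖mean (fun x : ℝ => u x) a b - c‖) := by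
    refine intervalIntegral.integral_mono_on hab.le (intervalIntegrable_norm_sub hg _ _ _)
      ((hi _ _).add intervalIntegrable_const) fun x _ => ?_
    rw [norm_sub_rev (mean _ a b)]
    exact norm_sub_le_norm_sub_add_norm_sub _ _ _
  rw [intervalIntegral.integral_add (hi _ _) intervalIntegrable_const,
    intervalIntegral.integral_const, smul_eq_mul] at i5
  linarith

end Poisson

/-! ### Fourier series with nonnegative modes -/

section Analytic

/-- The Fourier coefficients at negative modes vanish. -/
def IsAnalytic (g : Torus → ℂ) : Prop := ∀ n : ℤ, n < 0 → fourierCoeff g n = 0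

/-- The sum of the power series with the nonnegative Fourier coefficients of `g`. -/
def disc (g : Torus → ℂ) (z : ℂ) : ℂ := ∑' k : ℕ, fourierCoeff g (k : ℤ) * z ^ k

theorem fourierCoeff_eq_integral_mul (g : Torus → ℂ) (n : ℤ) :
    fourierCoeff g n = ∫ x, g x * fourier (-n) x ∂mu := by
  simp only [fourierCoeff, smul_eq_mul, mul_comm]

theorem fourier_nat (k : ℕ) (x : Torus) : fourier (k : ℤ) x = fourier 1 x ^ k := by
  induction k with
  | zero => simp
  | succ k ih => rw [Nat.cast_succ, fourier_add, ih, pow_succ]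

theorem fourier_neg_nat (k : ℕ) (x : Torus) : fourier (-(k : ℤ)) x = fourier (-1) x ^ k := by
  rw [fourier_neg, fourier_nat, map_pow, ← fourier_neg]

theorem norm_fourierCoeff_le (g : Torus → ℂ) (n : ℤ) : ‖fourierCoeff g n‖ ≤ ∫ x, ‖g x‖ ∂mu := by
  rw [fourierCoeff_eq_integral_mul]
  refine (norm_integral_le_integral_norm _).trans_eq ?_
  simp only [norm_mul, norm_fourier_apply, mul_one]

theorem summable_norm_disc (g : Torus → ℂ) {z : ℂ} (hz : ‖z‖ < 1) :
    Summable fun k : ℕ => ‖fourierCoeff g (k : ℤ) * z ^ k‖ := by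
  refine Summable.of_nonneg_of_le (fun _ => norm_nonneg _) (fun k => ?_)
    ((summable_geometric_of_lt_one (norm_nonneg z) hz).mul_left (∫ x, ‖g x‖ ∂mu))
  rw [norm_mul, norm_pow]
  exact mul_le_mul_of_nonneg_right (norm_fourierCoeff_le g _) (by positivity)

theorem integral_mul_inv_one_sub {g : Torus → ℂ} (hg : Integrable g mu) (q : C(Torus, ℂ))
    (hq : ∀ x, ‖q x‖ ≤ 1) {w : ℂ} (hw : ‖w‖ < 1) :
    ∫ x, g x * (1 - w * q x)⁻¹ ∂mu = ∑' k : ℕ, (∫ x, g x * q x ^ k ∂mu) * w ^ k := by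
  have hle : ∀ k x, ‖g x * q x ^ k * w ^ k‖ ≤ ‖g x‖ * ‖w‖ ^ k := by
    intro k x
    rw [norm_mul, norm_mul, norm_pow, norm_pow]
    gcongr
    exact mul_le_of_le_one_right (norm_nonneg _) (pow_le_one₀ (norm_nonneg _) (hq x))
  have hint : ∀ k : ℕ, Integrable (fun x => g x * q x ^ k * w ^ k) mu := fun k =>
    (hg.norm.mul_const (‖w‖ ^ k)).mono'
      ((hg.aestronglyMeasurable.mul (by fun_prop)).mul_const _) (Eventually.of_forall (hle k))
  have hsum : Summable fun k : ℕ => ∫ x, ‖g x * q x ^ k * w ^ k‖ ∂mu := by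
    refine Summable.of_nonneg_of_le (fun _ => integral_nonneg fun _ => norm_nonneg _) (fun k => ?_)
      ((summable_geometric_of_lt_one (norm_nonneg w) hw).mul_left (∫ x, ‖g x‖ ∂mu))
    rw [← integral_mul_const]
    exact integral_mono (hint k).norm (hg.norm.mul_const _) (hle k)
  have h := (hasSum_integral_of_summable_integral_norm hint hsum).tsum_eq
  simp only [integral_mul_const] at h
  rw [h]
  refine integral_congr_ae (Eventually.of_forall fun x => ?_)
  have hx : ‖w * q x‖ < 1 := by
    rw [norm_mul]
    exact (mul_le_of_le_one_right (norm_nonneg _) (hq x)).trans_lt hw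
  simp only [mul_assoc, tsum_mul_left, ← mul_pow]
  rw [mul_comm (q x), tsum_geometric_of_norm_lt_one hx]

theorem poisson_eq {z : ℂ} (hz : ‖z‖ < 1) (x : Torus) :
    (poisson z x : ℂ) = (1 - z * fourier (-1) x)⁻¹ + (1 - conj z * fourier 1 x)⁻¹ - 1 := by
  have hω : fourier 1 x * conj (fourier 1 x) = 1 := by
    rw [Complex.mul_conj, Complex.normSq_eq_norm_sq, norm_fourier_apply]; simp
  have h0 := fourier_sub_ne_zero hz x
  rw [fourier_neg]
  set ω := fourier 1 x
  have h0' : conj ω - conj z ≠ 0 := by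
    rw [← map_sub]; exact (map_ne_zero _).2 h0
  have hω0 : ω ≠ 0 := left_ne_zero_of_mul_eq_one hω
  have hω1 : conj ω ≠ 0 := right_ne_zero_of_mul_eq_one hω
  have hA : 1 - z * conj ω = conj ω * (ω - z) := by linear_combination -hω
  have hB : 1 - conj z * ω = ω * (conj ω - conj z) := by linear_combination -hω
  have hP : (poisson z x : ℂ) = (1 - z * conj z) / ((ω - z) * (conj ω - conj z)) := by
    rw [poisson, ← map_sub, Complex.mul_conj, Complex.mul_conj, Complex.normSq_eq_norm_sq,
      Complex.normSq_eq_norm_sq]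
    push_cast
    rfl
  rw [hP, hA, hB, div_eq_iff (mul_ne_zero h0 h0')]
  field_simp
  linear_combination (ω * conj ω - (z * conj ω + ω * conj z)) * hω

/-- The kernel is a geometric series in `z` plus one in `conj z`, minus `1`. The first produces the
power series; analyticity kills all of the second but its constant term, which the `-1` cancels. -/
theorem integral_mul_poisson {g : Torus → ℂ} (hg : Integrable g mu) (ha : IsAnalytic g) {z : ℂ}
    (hz : ‖z‖ < 1) : ∫ x, g x * poisson z x ∂mu = disc g z := by
  have hz' : ‖conj z‖ < 1 := by rwa [RCLike.norm_conj]
  have hi : ∀ (w : ℂ) (q : C(Torus, ℂ)), ‖w‖ < 1 → (∀ x, ‖q x‖ = 1) →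
      Integrable (fun x => g x * (1 - w * q x)⁻¹) mu := by
    intro w q hw hq
    have hc : Continuous fun x => (1 - w * q x)⁻¹ := by
      refine Continuous.inv₀ (by fun_prop) fun x hx => ?_
      have := congrArg norm (sub_eq_zero.1 hx)
      rw [norm_one, norm_mul, hq, mul_one] at this
      exact hw.ne' this
    exact hg.mul_bdd (c := (1 - ‖w‖)⁻¹) hc.aestronglyMeasurable (Eventually.of_forall fun x => by
      rw [norm_inv]
      refine inv_anti₀ (sub_pos.2 hw) ?_
      have := norm_sub_norm_le (1 : ℂ) (w * q x)
      rwa [norm_one, norm_mul, hq, mul_one] at this)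
  have hsplit : ∀ x, g x * poisson z x =
      g x * (1 - z * fourier (-1) x)⁻¹ + g x * (1 - conj z * fourier 1 x)⁻¹ - g x := by
    intro x; rw [poisson_eq hz]; ring
  simp only [hsplit]
  have i1 := hi z (fourier (-1)) hz (norm_fourier_apply _)
  have i2 := hi (conj z) (fourier 1) hz' (norm_fourier_apply _)
  rw [integral_sub (by exact i1.add i2) hg, integral_add i1 i2,
    integral_mul_inv_one_sub hg (fourier (-1)) (fun x => (norm_fourier_apply _ x).le) hz,
    integral_mul_inv_one_sub hg (fourier 1) (fun x => (norm_fourier_apply _ x).le) hz']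
  have e1 : ∀ k : ℕ, ∫ x, g x * fourier (-1) x ^ k ∂mu = fourierCoeff g k := by
    intro k
    rw [fourierCoeff_eq_integral_mul]
    simp only [fourier_neg_nat]
  have e2 : ∀ k : ℕ, ∫ x, g x * fourier 1 x ^ k ∂mu = fourierCoeff g (-k) := by
    intro k
    rw [fourierCoeff_eq_integral_mul, neg_neg]
    simp only [fourier_nat]
  simp only [e1, e2]
  rw [tsum_eq_single (f := fun k : ℕ => fourierCoeff g (-(k : ℤ)) * conj z ^ k) 0 fun k hk => by
    rw [ha _ (by omega), zero_mul]]
  have e3 : ∫ x, g x ∂mu = fourierCoeff g 0 := by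
    rw [fourierCoeff_eq_integral_mul]; simp
  rw [e3, disc]
  simp

theorem integrable_of_memLp_two {g : Torus → ℂ} (hg : MemLp g 2 mu) : Integrable g mu :=
  hg.integrable (by norm_num)

/-- Parseval for the pair `conj g · e^{inx}` and `h`. -/
theorem hasSum_fourierCoeff_mul {g h : Torus → ℂ} (hg : MemLp g 2 mu) (hh : MemLp h 2 mu) (n : ℤ) :
    HasSum (fun k => fourierCoeff g (n - k) * fourierCoeff h k)
      (fourierCoeff (fun x => g x * h x) n) := by
  have hq : MemLp (fun x => conj (g x) * fourier n x) 2 mu := by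
    refine hg.mono ?_ (Eventually.of_forall fun x => ?_)
    · exact (Complex.continuous_conj.comp_aestronglyMeasurable hg.1).mul
        (by fun_prop)
    · rw [norm_mul, RCLike.norm_conj, norm_fourier_apply, mul_one]
  have key := fourierBasis.hasSum_inner_mul_inner (hq.toLp _) (hh.toLp _)
  have hin : ∀ (y : Torus → ℂ) (hy : MemLp y 2 mu),
      inner ℂ (hq.toLp _) (hy.toLp _) = ∫ x, g x * y x * fourier (-n) x ∂mu := by
    intro y hy
    rw [L2.inner_def]
    refine integral_congr_ae ?_
    filter_upwards [hq.coeFn_toLp, hy.coeFn_toLp] with x h1 h2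
    rw [h1, h2, RCLike.inner_apply, map_mul, Complex.conj_conj, fourier_neg]
    ring
  have hb : ∀ k : ℤ, inner ℂ (hq.toLp _) (fourierBasis k) = fourierCoeff g (n - k) := by
    intro k
    have hk : MemLp (fourier k : Torus → ℂ) 2 mu := (fourier k).memLp mu ℂ
    have : (fourierBasis k : L2) = hk.toLp _ := by
      rw [coe_fourierBasis]; rfl
    rw [this, hin, fourierCoeff_eq_integral_mul]
    refine integral_congr_ae (Eventually.of_forall fun x => ?_)
    simp only
    rw [neg_sub, sub_eq_add_neg, fourier_add, mul_assoc]
  have hb' : ∀ k : ℤ, inner ℂ (fourierBasis k) (hh.toLp h) = fourierCoeff h k := by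
    intro k
    rw [coe_fourierBasis, inner_fourierLp]
    rw [fourierCoeff_congr_ae hh.coeFn_toLp]
  rw [hin, ← fourierCoeff_eq_integral_mul] at key
  simpa only [hb, hb'] using key

theorem IsAnalytic.mul {g h : Torus → ℂ} (hg : MemLp g 2 mu) (hh : MemLp h 2 mu)
    (ha : IsAnalytic g) (hb : IsAnalytic h) : IsAnalytic fun x => g x * h x := by
  intro n hn
  refine (hasSum_fourierCoeff_mul hg hh n).unique ?_
  convert! hasSum_zero with k
  by_cases hk : k < 0
  · rw [hb k hk, mul_zero]
  · rw [ha (n - k) (by omega), zero_mul]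

theorem fourierCoeff_mul_nat {g h : Torus → ℂ} (hg : MemLp g 2 mu) (hh : MemLp h 2 mu)
    (ha : IsAnalytic g) (hb : IsAnalytic h) (n : ℕ) :
    fourierCoeff (fun x => g x * h x) n =
      ∑ k ∈ Finset.range (n + 1), fourierCoeff g (k : ℤ) * fourierCoeff h ((n - k : ℕ) : ℤ) := by
  refine (hasSum_fourierCoeff_mul hg hh n).unique ?_
  rw [← Finset.sum_range_reflect]
  have h1 := hasSum_sum_of_ne_finset_zero (L := SummationFilter.unconditional ℤ)
    (f := fun k : ℤ => fourierCoeff g (n - k) * fourierCoeff h k)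
    (s := (Finset.range (n + 1)).map Nat.castEmbedding) (fun k hk => by
      by_cases hk0 : k < 0
      · rw [hb k hk0, mul_zero]
      · rw [ha (n - k), zero_mul]
        by_contra hcon
        refine hk (Finset.mem_map.2 ⟨k.toNat, Finset.mem_range.2 (by omega), ?_⟩)
        exact Int.toNat_of_nonneg (by omega))
  rw [Finset.sum_map] at h1
  convert! h1 using 1
  refine Finset.sum_congr rfl fun k hk => ?_
  have := Finset.mem_range.1 hk
  simp only [Nat.castEmbedding_apply]
  congr 2 <;> omega

theorem disc_mul {g h : Torus → ℂ} (hg : MemLp g 2 mu) (hh : MemLp h 2 mu)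
    (ha : IsAnalytic g) (hb : IsAnalytic h) {z : ℂ} (hz : ‖z‖ < 1) :
    disc (fun x => g x * h x) z = disc g z * disc h z := by
  unfold disc
  rw [tsum_mul_tsum_eq_tsum_sum_range_of_summable_norm (summable_norm_disc g hz)
    (summable_norm_disc h hz)]
  refine tsum_congr fun n => ?_
  rw [fourierCoeff_mul_nat hg hh ha hb, Finset.sum_mul]
  refine Finset.sum_congr rfl fun k hk => ?_
  have := Finset.mem_range.1 hk
  rw [mul_mul_mul_comm, ← pow_add, Nat.add_sub_cancel' (by omega)]

theorem disc_zero (g : Torus → ℂ) : disc g 0 = fourierCoeff g 0 := by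
  unfold disc
  rw [tsum_eq_single 0 fun k hk => by rw [zero_pow hk, mul_zero]]
  simp

end Analytic

/-! ### Composition with `z f(z)` for an inner function `f` -/

section Composition

/-- Trigonometric polynomials form a star subalgebra that separates points. -/
theorem measure_ext_of_fourier {ν ν' : Measure Torus} [IsFiniteMeasure ν] [IsFiniteMeasure ν']
    (h : ∀ n : ℤ, ∫ x, fourier n x ∂ν = ∫ x, fourier n x ∂ν') : ν = ν' := by
  let A : StarSubalgebra ℂ (BoundedContinuousFunction Torus ℂ) :=
    (fourierSubalgebra (T := 2 * π)).comap (BoundedContinuousFunction.toContinuousMapStarₐ ℂ)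
  refine ext_of_forall_mem_subalgebra_integral_eq_of_polish (𝕜 := ℂ) (A := A) ?_ ?_
  · intro x y hxy
    obtain ⟨-, ⟨g, hg, rfl⟩, hne⟩ := fourierSubalgebra_separatesPoints (T := 2 * π) hxy
    exact ⟨g, ⟨g, ⟨BoundedContinuousFunction.mkOfCompact g, hg, rfl⟩, rfl⟩, hne⟩
  · intro g hg
    have hg' : (g : C(Torus, ℂ)) ∈ Submodule.span ℂ (range (fourier (T := 2 * π))) := by
      rw [← fourierSubalgebra_coe]; exact hg
    have key : ∀ q : C(Torus, ℂ), q ∈ Submodule.span ℂ (range (fourier (T := 2 * π))) →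
        ∫ x, q x ∂ν = ∫ x, q x ∂ν' := by
      intro q hq
      have hint : ∀ (ρ : Measure Torus) [IsFiniteMeasure ρ] (q : C(Torus, ℂ)), Integrable q ρ :=
        fun ρ _ q => (q.memLp (p := 1) ρ ℂ).integrable le_rfl
      induction hq using Submodule.span_induction with
      | mem q hq => obtain ⟨n, rfl⟩ := hq; exact h n
      | zero => simp
      | add a b _ _ ha hb =>
        simp only [ContinuousMap.add_apply]
        rw [integral_add (hint ν a) (hint ν b), integral_add (hint ν' a) (hint ν' b), ha, hb]
      | smul c a _ ha =>
        simp only [ContinuousMap.smul_apply]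
        rw [integral_smul, integral_smul, ha]
    exact key g hg'

/-- The probability measure on the circle whose density is the Poisson kernel. -/
def poissonMeasure (z : ℂ) : Measure Torus := mu.withDensity fun x => ENNReal.ofReal (poisson z x)

theorem integral_poissonMeasure {E : Type*} [NormedAddCommGroup E] [NormedSpace ℝ E] {z : ℂ}
    (hz : ‖z‖ < 1) (g : Torus → E) :
    ∫ x, g x ∂poissonMeasure z = ∫ x, poisson z x • g x ∂mu := by
  rw [poissonMeasure, integral_withDensity_eq_integral_toReal_smul
    (continuous_poisson hz).measurable.ennreal_ofReal
    (Eventually.of_forall fun _ => ENNReal.ofReal_lt_top)]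
  simp only [ENNReal.toReal_ofReal (poisson_nonneg hz _)]

theorem integrable_poisson {z : ℂ} (hz : ‖z‖ < 1) : Integrable (poisson z) mu :=
  ((⟨poisson z, continuous_poisson hz⟩ : C(Torus, ℝ)).memLp (p := 1) mu ℝ).integrable le_rfl

theorem isFiniteMeasure_poissonMeasure {z : ℂ} (hz : ‖z‖ < 1) :
    IsFiniteMeasure (poissonMeasure z) :=
  isFiniteMeasure_withDensity_ofReal (integrable_poisson hz).2

theorem poissonMeasure_zero : poissonMeasure 0 = mu := by
  have : poisson 0 = fun _ => 1 := by
    ext x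
    rw [poisson, sub_zero, norm_fourier_apply]; simp
  rw [poissonMeasure, this]
  simp

theorem memLp_fourier (n : ℤ) : MemLp (fun x : Torus => fourier n x) 2 mu := (fourier n).memLp mu ℂ

theorem isAnalytic_fourier {n : ℤ} (hn : 0 ≤ n) : IsAnalytic fun x => fourier n x := by
  intro m hm
  rw [fourierCoeff_fourier, Pi.single_eq_of_ne (by omega)]

theorem disc_fourier (n : ℕ) (z : ℂ) : disc (fun x => fourier (n : ℤ) x) z = z ^ n := by
  unfold disc
  rw [tsum_eq_single n fun k hk => by
    rw [fourierCoeff_fourier, Pi.single_eq_of_ne (by exact_mod_cast hk), zero_mul]]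
  rw [fourierCoeff_fourier, Pi.single_eq_same, one_mul]

theorem integral_poisson {z : ℂ} (hz : ‖z‖ < 1) : ∫ x, poisson z x ∂mu = 1 := by
  have h := integral_mul_poisson (integrable_of_memLp_two (memLp_fourier 0))
    (isAnalytic_fourier le_rfl) hz
  have h2 := disc_fourier 0 z
  simp only [Nat.cast_zero, pow_zero] at h2
  rw [h2] at h
  simp only [fourier_zero, one_mul] at h
  exact Complex.ofReal_injective ((integral_ofReal (𝕜 := ℂ) (f := poisson z)).symm.trans h)

variable {f : L2}

theorem IsInner.isAnalytic (hf : IsInner f) : IsAnalytic f := (mem_hardySpace_iff f).1 hf.1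

theorem norm_disc_le_of_ae_norm_le {g : Torus → ℂ} (hg : Integrable g mu) (ha : IsAnalytic g)
    (h1 : ∀ᵐ x ∂mu, ‖g x‖ ≤ 1) {z : ℂ} (hz : ‖z‖ < 1) : ‖disc g z‖ ≤ 1 := by
  rw [← integral_mul_poisson hg ha hz, ← integral_poisson hz]
  refine norm_integral_le_of_norm_le (integrable_poisson hz) ?_
  filter_upwards [h1] with x hx
  rw [norm_mul, Complex.norm_of_nonneg (poisson_nonneg hz x)]
  exact mul_le_of_le_one_left (poisson_nonneg hz x) hx

theorem IsInner.norm_mul_discFun_lt (hf : IsInner f) {z : ℂ} (hz : ‖z‖ < 1) :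
    ‖z * discFun f z‖ < 1 := by
  rw [norm_mul]
  refine (mul_le_of_le_one_right (norm_nonneg z) ?_).trans_lt hz
  exact norm_disc_le_of_ae_norm_le (integrable_of_memLp_two (Lp.memLp f)) hf.isAnalytic
    (hf.2.mono fun x hx => hx.le) hz

/-- The map of the circle induced by the boundary values of `z f(z)`. -/
def innerMap (f : L2) (x : Torus) : Torus := ((Complex.arg (fourier 1 x * f x) : ℝ) : Torus)

theorem measurable_innerMap (f : L2) : Measurable (innerMap f) := by
  have h : Measurable (f : Torus → ℂ) := (Lp.stronglyMeasurable f).measurable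
  unfold innerMap
  have h2 : Measurable fun x : Torus => fourier 1 x * f x :=
    (ContinuousMap.continuous _).measurable.mul h
  exact AddCircle.measurable_mk'.comp (Complex.measurable_arg.comp h2)

theorem IsInner.fourier_innerMap (hf : IsInner f) :
    ∀ᵐ x ∂mu, fourier 1 (innerMap f x) = fourier 1 x * f x := by
  filter_upwards [hf.2] with x hx
  have h := Complex.norm_mul_exp_arg_mul_I (fourier 1 x * f x)
  rw [norm_mul, norm_fourier_apply, hx] at h
  rw [innerMap, fourier_one_coe, mul_comm Complex.I]
  simpa using h

theorem memLp_fourier_innerMap (f : L2) (n : ℤ) :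
    MemLp (fun x => fourier n (innerMap f x)) 2 mu := by
  refine MemLp.of_bound (C := 1) ?_ (Eventually.of_forall fun x => (norm_fourier_apply _ _).le)
  exact ((fourier n).continuous.measurable.comp (measurable_innerMap f)).aestronglyMeasurable

theorem disc_congr_ae {g h : Torus → ℂ} (hgh : g =ᵐ[mu] h) (z : ℂ) : disc g z = disc h z := by
  unfold disc; rw [fourierCoeff_congr_ae hgh]

/-- The boundary function is the `n`-th power of `e^{ix} f`, so induction with `IsAnalytic.mul` and
`disc_mul` applies. -/
theorem IsInner.isAnalytic_fourier_innerMap (hf : IsInner f) (n : ℕ) :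
    IsAnalytic (fun x => fourier (n : ℤ) (innerMap f x)) ∧ ∀ z : ℂ, ‖z‖ < 1 →
      disc (fun x => fourier (n : ℤ) (innerMap f x)) z = (z * discFun f z) ^ n := by
  have h1 : IsAnalytic (fun x => fourier 1 (innerMap f x)) ∧ ∀ z : ℂ, ‖z‖ < 1 →
      disc (fun x => fourier 1 (innerMap f x)) z = z * discFun f z := by
    constructor
    · intro m hm
      rw [fourierCoeff_congr_ae hf.fourier_innerMap]
      exact (isAnalytic_fourier zero_le_one).mul (memLp_fourier 1) (Lp.memLp f) hf.isAnalytic m hm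
    · intro z hz
      rw [disc_congr_ae hf.fourier_innerMap, disc_mul (memLp_fourier 1) (Lp.memLp f)
        (isAnalytic_fourier zero_le_one) hf.isAnalytic hz]
      have := disc_fourier 1 z
      rw [Nat.cast_one, pow_one] at this
      rw [this]; rfl
  induction n with
  | zero =>
    simp only [Nat.cast_zero, fourier_zero, pow_zero]
    have h2 := isAnalytic_fourier (le_refl 0)
    have h3 := disc_fourier 0
    simp only [Nat.cast_zero, fourier_zero, pow_zero] at h2 h3
    exact ⟨h2, fun z _ => h3 z⟩
  | succ n ih =>
    simp only [Nat.cast_succ, fourier_add]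
    refine ⟨ih.1.mul (memLp_fourier_innerMap f n) (memLp_fourier_innerMap f 1) h1.1, fun z hz => ?_⟩
    rw [disc_mul (memLp_fourier_innerMap f n) (memLp_fourier_innerMap f 1) ih.1 h1.1 hz,
      ih.2 z hz, h1.2 z hz, pow_succ]

theorem fourierCoeff_conj (g : Torus → ℂ) (n : ℤ) :
    fourierCoeff (fun x => conj (g x)) n = conj (fourierCoeff g (-n)) := by
  rw [fourierCoeff_eq_integral_mul, fourierCoeff_eq_integral_mul, ← integral_conj]
  simp only [map_mul, ← fourier_neg, neg_neg]

theorem IsInner.fourierCoeff_innerMap_eq_zero (hf : IsInner f) {k n : ℤ}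
    (h : 0 ≤ k ∧ n < 0 ∨ k < 0 ∧ 0 ≤ n) :
    fourierCoeff (fun x => fourier k (innerMap f x)) n = 0 := by
  rcases h with ⟨hk, hn⟩ | ⟨hk, hn⟩
  · lift k to ℕ using hk
    exact (hf.isAnalytic_fourier_innerMap k).1 n hn
  · obtain ⟨m, rfl⟩ : ∃ m : ℕ, k = -(m : ℤ) := ⟨(-k).toNat, by omega⟩
    simp only [fourier_neg]
    rw [fourierCoeff_conj, map_eq_zero]
    obtain ⟨ha, hd⟩ := hf.isAnalytic_fourier_innerMap m
    rcases hn.lt_or_eq with hn | rfl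
    · exact ha _ (by omega)
    -- The zero mode is where the factor `z` matters: a positive power of `z f(z)` vanishes at the
    -- origin.
    · rw [neg_zero, ← disc_zero, hd 0 (by simp), zero_mul, zero_pow (by omega)]

/-- Both measures have `n`-th moment `(z f(z))^n` for `n ≥ 0`, and the negative moments follow by
conjugation since the kernel is real. -/
theorem IsInner.map_poissonMeasure (hf : IsInner f) {z : ℂ} (hz : ‖z‖ < 1) :
    (poissonMeasure z).map (innerMap f) = poissonMeasure (z * discFun f z) := by
  have hw := hf.norm_mul_discFun_lt hz
  have := isFiniteMeasure_poissonMeasure hz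
  have := isFiniteMeasure_poissonMeasure hw
  have hmap : ∀ n : ℤ, ∫ x, fourier n x ∂((poissonMeasure z).map (innerMap f)) =
      ∫ x, fourier n (innerMap f x) * poisson z x ∂mu := by
    intro n
    rw [integral_map (measurable_innerMap f).aemeasurable
      (fourier n).continuous.aestronglyMeasurable, integral_poissonMeasure hz]
    simp only [Complex.real_smul, mul_comm]
  have hright : ∀ n : ℤ, ∫ x, fourier n x ∂(poissonMeasure (z * discFun f z)) =
      ∫ x, fourier n x * poisson (z * discFun f z) x ∂mu := by
    intro n
    rw [integral_poissonMeasure hw]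
    simp only [Complex.real_smul, mul_comm]
  have hnat : ∀ n : ℕ, ∫ x, fourier (n : ℤ) (innerMap f x) * poisson z x ∂mu =
      ∫ x, fourier (n : ℤ) x * poisson (z * discFun f z) x ∂mu := by
    intro n
    obtain ⟨ha, hd⟩ := hf.isAnalytic_fourier_innerMap n
    rw [integral_mul_poisson (integrable_of_memLp_two (memLp_fourier_innerMap f n)) ha hz, hd z hz,
      integral_mul_poisson (integrable_of_memLp_two (memLp_fourier n))
        (isAnalytic_fourier (Int.natCast_nonneg n)) hw, disc_fourier]
  refine measure_ext_of_fourier fun n => ?_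
  rw [hmap, hright]
  obtain ⟨m, rfl | rfl⟩ := n.eq_nat_or_neg
  · exact hnat m
  · have h := congrArg conj (hnat m)
    rw [← integral_conj, ← integral_conj] at h
    simpa only [map_mul, Complex.conj_ofReal, ← fourier_neg] using h

theorem IsInner.measurePreserving (hf : IsInner f) : MeasurePreserving (innerMap f) mu mu := by
  refine ⟨measurable_innerMap f, ?_⟩
  have h := hf.map_poissonMeasure (z := 0) (by simp)
  rwa [zero_mul, poissonMeasure_zero] at h

theorem IsInner.integral_comp_mul_poisson (hf : IsInner f) {E : Type*} [NormedAddCommGroup E]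
    [NormedSpace ℝ E] {z : ℂ} (hz : ‖z‖ < 1) {g : Torus → E} (hg : AEStronglyMeasurable g mu) :
    ∫ x, poisson z x • g (innerMap f x) ∂mu = ∫ x, poisson (z * discFun f z) x • g x ∂mu := by
  rw [← integral_poissonMeasure hz (fun x => g (innerMap f x)),
    ← integral_poissonMeasure (hf.norm_mul_discFun_lt hz), ← hf.map_poissonMeasure hz,
    integral_map (measurable_innerMap f).aemeasurable]
  rw [hf.map_poissonMeasure hz]
  exact hg.mono_ac (withDensity_absolutelyContinuous _ _)

/-! ### The composition operator and what it preserves. -/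

/-- The operator `u ↦ u(z f(z))` on `L²`. -/
def compInner (hf : IsInner f) : L2 →ₗᵢ[ℂ] L2 :=
  Lp.compMeasurePreservingₗᵢ ℂ (innerMap f) hf.measurePreserving

theorem coeFn_compInner (hf : IsInner f) (u : L2) :
    ∀ᵐ x ∂mu, compInner hf u x = u (innerMap f x) :=
  Lp.coeFn_compMeasurePreserving u hf.measurePreserving

theorem hasSum_fourierCoeff_compInner (hf : IsInner f) (u : L2) (n : ℤ) :
    HasSum (fun k => fourierCoeff u k * fourierCoeff (fun x => fourier k (innerMap f x)) n)
      (fourierCoeff (compInner hf u) n) := by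
  have h := ((hasSum_fourier_series_L2 u).mapL (compInner hf).toContinuousLinearMap).mapL
    (innerSL ℂ (fourierLp (T := 2 * π) 2 n))
  simp only [innerSL_apply_apply, LinearIsometry.coe_toContinuousLinearMap, map_smul,
    inner_fourierLp] at h
  convert! h using 3 with k
  refine congrFun (fourierCoeff_congr_ae ?_) n
  filter_upwards [coeFn_compInner hf (fourierLp 2 k),
    hf.measurePreserving.quasiMeasurePreserving.ae (coeFn_fourierLp (T := 2 * π) 2 k)] with x h1 h2
  rw [h1, h2]

theorem ext_fourierCoeff {u v : L2} (h : ∀ n, fourierCoeff u n = fourierCoeff v n) : u = v := by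
  apply fourierBasis.repr.injective
  ext n
  rw [fourierBasis_repr, fourierBasis_repr, h n]

/-- Composition does not mix the modes `k ≥ 0` with the modes `k < 0`, so truncating before or after
gives the same coefficients. -/
theorem compInner_szego (hf : IsInner f) (u : L2) :
    compInner hf (szego u) = szego (compInner hf u) := by
  refine ext_fourierCoeff fun n => ?_
  refine (hasSum_fourierCoeff_compInner hf (szego u) n).unique ?_
  rw [fourierCoeff_szego]
  have h := hasSum_fourierCoeff_compInner hf u n
  split_ifs with hn
  · convert! h using 2 with k
    rw [fourierCoeff_szego]
    split_ifs with hk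
    · rfl
    · rw [hf.fourierCoeff_innerMap_eq_zero (Or.inr ⟨by omega, hn⟩), mul_zero, mul_zero]
  · convert! hasSum_zero with k
    rw [fourierCoeff_szego]
    split_ifs with hk
    · rw [hf.fourierCoeff_innerMap_eq_zero (Or.inl ⟨hk, by omega⟩), mul_zero]
    · rw [zero_mul]

theorem szego_eq_self {u : L2} (hu : u ∈ hardySpace) : szego u = u := by
  refine ext_fourierCoeff fun n => ?_
  rw [fourierCoeff_szego]
  split_ifs with hn
  · rfl
  · exact ((mem_hardySpace_iff u).1 hu n (by omega)).symm

theorem compInner_mem_hardySpace (hf : IsInner f) {u : L2} (hu : u ∈ hardySpace) :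
    compInner hf u ∈ hardySpace := by
  rw [mem_hardySpace_iff]
  intro n hn
  rw [← szego_eq_self hu, compInner_szego, fourierCoeff_szego, if_neg (by omega)]

/-- Links the boundary composition to the one in the disc: both values are Poisson integrals,
related by the change of variables. -/
theorem discFun_compInner (hf : IsInner f) {u : L2} (hu : u ∈ hardySpace) {z : ℂ} (hz : ‖z‖ < 1) :
    discFun (compInner hf u) z = discFun u (z * discFun f z) := by
  have h1 := integral_mul_poisson (integrable_of_memLp_two (Lp.memLp (compInner hf u)))
    ((mem_hardySpace_iff _).1 (compInner_mem_hardySpace hf hu)) hz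
  have h2 := integral_mul_poisson (integrable_of_memLp_two (Lp.memLp u))
    ((mem_hardySpace_iff _).1 hu) (hf.norm_mul_discFun_lt hz)
  have h3 := hf.integral_comp_mul_poisson hz (Lp.aestronglyMeasurable u)
  refine h1.symm.trans (Eq.trans ?_ h2)
  simp only [Complex.real_smul] at h3
  simp only [mul_comm]
  refine Eq.trans (integral_congr_ae ?_) h3
  filter_upwards [coeFn_compInner hf u] with x hx
  rw [hx]

theorem meanOscLE_compInner (hf : IsInner f) {u : L2} {C : ℝ} (h : MeanOscLE u C) :
    MeanOscLE (compInner hf u) (2 * (1 + π) ^ 2 * (48 * C)) := by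
  refine meanOscLE_of_integral_poisson_mul_le (integrable_of_memLp_two (Lp.memLp _)) fun z hz => ?_
  obtain ⟨c, hc⟩ := exists_integral_poisson_mul_le (integrable_of_memLp_two (Lp.memLp u)) h
    (hf.norm_mul_discFun_lt hz)
  refine ⟨c, le_of_eq_of_le ?_ hc⟩
  have h3 := hf.integral_comp_mul_poisson hz (g := fun x => ‖u x - c‖)
    ((Lp.aestronglyMeasurable u).sub aestronglyMeasurable_const).norm
  refine Eq.trans (integral_congr_ae ?_) h3
  filter_upwards [coeFn_compInner hf u] with x hx
  rw [hx]; rfl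

theorem compInner_mem_BMOplus (hf : IsInner f) {u : L2} (hu : u ∈ BMOplus) :
    compInner hf u ∈ BMOplus := by
  obtain ⟨h1, h2, C, hC⟩ := hu
  exact ⟨compInner_mem_hardySpace hf h1, integrable_of_memLp_two (Lp.memLp _), _,
    meanOscLE_compInner hf hC⟩

theorem J_compInner (hf : IsInner f) (u : L2) : J (compInner hf u) = J u := by
  unfold J
  have hm : AEStronglyMeasurable (fun x => (‖u x‖ : ℂ) ^ 2 * u x) mu := by
    have h := Lp.aestronglyMeasurable u
    exact ((Complex.continuous_ofReal.comp_aestronglyMeasurable h.norm).pow 2).mul h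
  have h := integral_map (measurable_innerMap f).aemeasurable (μ := mu)
    (by rwa [hf.measurePreserving.map_eq])
  rw [hf.measurePreserving.map_eq] at h
  refine Eq.trans (integral_congr_ae ?_) h.symm
  filter_upwards [coeFn_compInner hf u] with x hx
  rw [hx]

theorem IsSolution.compInner (hf : IsInner f) {u : ℝ → L2} (hu : IsSolution u) :
    IsSolution fun t => compInner hf (u t) where
  mem_BMOplus t := compInner_mem_BMOplus hf (hu.mem_BMOplus t)
  locally_bounded R := by
    obtain ⟨C, hC⟩ := hu.locally_bounded R
    exact ⟨_, fun t ht => meanOscLE_compInner hf (hC t ht)⟩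
  equation t := by
    obtain ⟨p, q, u', hp, hq, hd, heq⟩ := hu.equation t
    have hqm := hf.measurePreserving.quasiMeasurePreserving
    refine ⟨QuadSzego.compInner hf p, QuadSzego.compInner hf q, QuadSzego.compInner hf u',
      ?_, ?_, ?_, ?_⟩
    · filter_upwards [coeFn_compInner hf p, coeFn_compInner hf (u t), hqm.ae hp] with x h1 h2 h3
      rw [h1, h2, h3]
    · filter_upwards [coeFn_compInner hf q, coeFn_compInner hf (u t), hqm.ae hq] with x h1 h2 h3
      rw [h1, h2, h3]
    · exact ((QuadSzego.compInner hf).toContinuousLinearMap.restrictScalars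
        ℝ).hasFDerivAt.comp_hasDerivAt t hd
    · rw [← map_smul, heq, map_add, map_smul, map_smul, compInner_szego, J_compInner]

end Composition

/-! ### Uniqueness -/

section Uniqueness

theorem norm_sq_eq_integral (v : L2) : ‖v‖ ^ 2 = ∫ x, ‖v x‖ ^ 2 ∂mu := by
  have h := congrArg Complex.re (L2.inner_def (𝕜 := ℂ) v v)
  rw [inner_self_eq_norm_sq_to_K] at h
  have h2 : ∀ x, inner ℂ (v x) (v x) = ((‖v x‖ ^ 2 : ℝ) : ℂ) := fun x => by
    rw [inner_self_eq_norm_sq_to_K]; simp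
  simp only [h2] at h
  rw [integral_complex_ofReal, Complex.ofReal_re] at h
  rw [← h]
  norm_cast

theorem integrable_norm_sq (v : L2) : Integrable (fun x => ‖v x‖ ^ 2) mu :=
  (Lp.memLp v).integrable_norm_pow (by norm_num)

theorem norm_sq_le_integral {v : L2} {g : Torus → ℝ} (hg : Integrable g mu)
    (h : ∀ᵐ x ∂mu, ‖v x‖ ^ 2 ≤ g x) : ‖v‖ ^ 2 ≤ ∫ x, g x ∂mu := by
  rw [norm_sq_eq_integral]
  exact integral_mono_ae (integrable_norm_sq v) hg h

theorem integral_norm_le_half (v : L2) : ∫ x, ‖v x‖ ∂mu ≤ (1 + ‖v‖ ^ 2) / 2 := by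
  rw [norm_sq_eq_integral]
  have hi := integrable_norm_sq v
  have h : ∫ x, ‖v x‖ ∂mu ≤ ∫ x, (1 + ‖v x‖ ^ 2) / 2 ∂mu := by
    refine integral_mono (integrable_of_memLp_two (Lp.memLp v)).norm
      (((integrable_const 1).add hi).div_const 2) fun x => ?_
    simp only
    nlinarith [sq_nonneg (‖v x‖ - 1)]
  rw [integral_div, integral_add (integrable_const _) hi] at h
  simpa using h

/-- Exponential integrability of functions of bounded mean oscillation. -/
theorem integrable_exp_norm {v : L2} {C B : ℝ} (hC : 0 < C) (h : MeanOscLE v C) (hB : ‖v‖ ≤ B) :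
    Integrable (fun x => Real.exp (1 / (10 * C) * ‖v x‖)) mu ∧
      ∫ x, Real.exp (1 / (10 * C) * ‖v x‖) ∂mu ≤
        4 * Real.exp (1 / (10 * C) * ((1 + B ^ 2) / 2)) := by
  have hπ := Real.pi_pos
  have hv := integrable_of_memLp_two (Lp.memLp v)
  have hg := locallyIntegrable_lift hv
  -- John–Nirenberg controls `v` only up to its mean over the circle, which the `L²` norm bounds.
  have hm : ‖mean (fun x : ℝ => v x) (-π) (-π + 2 * π)‖ ≤ (1 + B ^ 2) / 2 := by
    have h1 := norm_mean_sub_mul_le hg 0 (show -π < -π + 2 * π by linarith)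
    have h2 := integral_mu_eq (fun x => ‖v x‖) 0
    have h3 := integral_norm_le_half v
    simp only [sub_zero] at h1
    rw [show (0 : ℝ) - π = -π by ring, show (0 : ℝ) + π = -π + 2 * π by ring] at h2
    have h4 : ‖v‖ ^ 2 ≤ B ^ 2 := by gcongr
    have h5 : ‖mean (fun x : ℝ => v x) (-π) (-π + 2 * π)‖ ≤ ∫ x, ‖v x‖ ∂mu := by
      rw [h2, ← div_eq_inv_mul, le_div_iff₀ (by positivity)]
      refine le_trans (le_of_eq ?_) h1
      ring
    linarith
  set m := mean (fun x : ℝ => v x) (-π) (-π + 2 * π) with hmdef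
  have hjn := lintegral_exp_norm_sub_mean_le hg hC ((meanOscLE_iff _ _).1 h)
    (show -π < -π + 2 * π by linarith) (by linarith)
  rw [← hmdef, show 4 * (-π + 2 * π - -π) = 2 * π * 4 by ring] at hjn
  set l := 1 / (10 * C) with hl
  have hl0 : 0 < l := by positivity
  have hjn2 : ∫⁻ x, ENNReal.ofReal (Real.exp (l * ‖v x - m‖)) ∂mu ≤ ENNReal.ofReal 4 := by
    have e := AddCircle.lintegral_preimage (2 * π) (-π)
      (fun x => ENNReal.ofReal (Real.exp (l * ‖v x - m‖)))
    rw [AddCircle.volume_eq_smul_haarAddCircle, lintegral_smul_measure] at e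
    rw [e, ENNReal.ofReal_mul (q := 4) (by positivity), smul_eq_mul] at hjn
    exact (ENNReal.mul_le_mul_iff_right (ENNReal.ofReal_pos.2 Real.two_pi_pos).ne'
      ENNReal.ofReal_ne_top).1 hjn
  have hmeas : AEStronglyMeasurable (fun x => Real.exp (l * ‖v x‖)) mu :=
    Real.continuous_exp.comp_aestronglyMeasurable
      ((Lp.aestronglyMeasurable v).norm.const_mul l)
  have hlin : ∫⁻ x, ENNReal.ofReal (Real.exp (l * ‖v x‖)) ∂mu ≤
      ENNReal.ofReal (4 * Real.exp (l * ((1 + B ^ 2) / 2))) := by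
    calc _ ≤ ∫⁻ x, ENNReal.ofReal (Real.exp (l * ((1 + B ^ 2) / 2))) *
          ENNReal.ofReal (Real.exp (l * ‖v x - m‖)) ∂mu := by
          refine lintegral_mono fun x => ?_
          simp only
          rw [← ENNReal.ofReal_mul (Real.exp_pos _).le, ← Real.exp_add, ← mul_add]
          refine ENNReal.ofReal_le_ofReal (Real.exp_le_exp.2 ?_)
          gcongr
          have := norm_add_le (v x - m) m
          rw [sub_add_cancel] at this
          linarith
      _ ≤ _ := by
          rw [lintegral_const_mul' _ _ ENNReal.ofReal_ne_top, mul_comm 4,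
            ENNReal.ofReal_mul (Real.exp_pos _).le]
          gcongr
  refine ⟨⟨hmeas, ?_⟩, ?_⟩
  · rw [hasFiniteIntegral_iff_ofReal (Eventually.of_forall fun x => (Real.exp_pos _).le)]
    exact hlin.trans_lt ENNReal.ofReal_lt_top
  · rw [integral_eq_lintegral_of_nonneg_ae (Eventually.of_forall fun x => (Real.exp_pos _).le)
      hmeas]
    exact ENNReal.toReal_le_of_le_ofReal (by positivity) hlin

/-! ### Almost Lipschitz bounds for the quadratic terms. -/

theorem pow_four_le_exp {x : ℝ} (hx : 0 ≤ x) {k : ℝ} (hk : 0 < k) :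
    x ^ 4 ≤ 24 / k ^ 4 * Real.exp (k * x) := by
  have h := Real.pow_div_factorial_le_exp (k * x) (by positivity) 4
  have h4 : ((Nat.factorial 4 : ℕ) : ℝ) = 24 := by norm_num [Nat.factorial]
  rw [h4, mul_pow, div_le_iff₀ (by norm_num)] at h
  rw [div_mul_eq_mul_div, le_div_iff₀ (by positivity)]
  linarith

/-- Cut at height `N`. Above it, `d²G² ≤ G⁴` is absorbed by half of the exponential rate, and the
other half yields the small factor. -/
theorem sq_mul_sq_le {d G N k : ℝ} (hd : 0 ≤ d) (hdG : d ≤ G) (hk : 0 < k) :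
    d ^ 2 * G ^ 2 ≤ N ^ 2 * d ^ 2 +
      24 / (k / 2) ^ 4 * Real.exp (-(k / 2 * N)) * Real.exp (k * G) := by
  by_cases hG : G ≤ N
  · have h1 : d ^ 2 * G ^ 2 ≤ d ^ 2 * N ^ 2 := by
      have : 0 ≤ G := hd.trans hdG
      gcongr
    have h2 : 0 ≤ 24 / (k / 2) ^ 4 * Real.exp (-(k / 2 * N)) * Real.exp (k * G) := by positivity
    linarith
  · have hG' := (not_le.1 hG).le
    have hG0 : 0 ≤ G := hd.trans hdG
    have h1 : d ^ 2 * G ^ 2 ≤ G ^ 2 * G ^ 2 := by gcongr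
    have h2 := pow_four_le_exp hG0 (half_pos hk)
    have h3 : Real.exp (k / 2 * G) ≤ Real.exp (-(k / 2 * N)) * Real.exp (k * G) := by
      rw [← Real.exp_add]
      refine Real.exp_le_exp.2 ?_
      nlinarith
    have h4 := mul_le_mul_of_nonneg_left h3 (show 0 ≤ 24 / (k / 2) ^ 4 by positivity)
    have h5 : 0 ≤ N ^ 2 * d ^ 2 := by positivity
    nlinarith

theorem norm_le_of_pow_four {v p : L2} {l M : ℝ} (hl : 0 < l)
    (hi : Integrable (fun x => Real.exp (l * ‖v x‖)) mu)
    (hM : ∫ x, Real.exp (l * ‖v x‖) ∂mu ≤ M) (hp : ∀ᵐ x ∂mu, ‖p x‖ = ‖v x‖ ^ 2) :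
    ‖p‖ ≤ √(24 / l ^ 4 * M) := by
  refine Real.le_sqrt_of_sq_le ?_
  refine (norm_sq_le_integral (hi.const_mul (24 / l ^ 4)) ?_).trans ?_
  · filter_upwards [hp] with x hx
    rw [hx, ← pow_mul]
    exact pow_four_le_exp (norm_nonneg _) hl
  · rw [integral_const_mul]
    gcongr

theorem norm_sub_le_of_exp {v w a b : L2} {l M : ℝ} (hl : 0 < l)
    (hv : Integrable (fun x => Real.exp (l * ‖v x‖)) mu)
    (hvM : ∫ x, Real.exp (l * ‖v x‖) ∂mu ≤ M)
    (hw : Integrable (fun x => Real.exp (l * ‖w x‖)) mu)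
    (hwM : ∫ x, Real.exp (l * ‖w x‖) ∂mu ≤ M)
    (hab : ∀ᵐ x ∂mu, ‖a x - b x‖ ≤ ‖v x - w x‖ * (‖v x‖ + ‖w x‖)) {N : ℝ} (hN : 0 ≤ N) :
    ‖a - b‖ ≤ N * ‖v - w‖ + √(24 / (l / 4) ^ 4 * (2 * M)) * Real.exp (-(l / 8 * N)) := by
  -- Half the rate, so that `exp(k(‖v‖ + ‖w‖))` is at most `exp(l max(‖v‖, ‖w‖))`. The cut halves
  -- the rate again, and the final square root once more, whence `l / 8`.
  set k := l / 2 with hk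
  have hk0 : 0 < k := by positivity
  have e4 : l / 4 = k / 2 := by rw [hk]; ring
  have e8 : l / 8 = k / 2 / 2 := by rw [hk]; ring
  rw [e4, e8]
  have hM : 0 ≤ M := (integral_nonneg fun x => (Real.exp_pos _).le).trans hvM
  set g : Torus → ℝ := fun x => N ^ 2 * ‖(v - w) x‖ ^ 2 + 24 / (k / 2) ^ 4 *
    Real.exp (-(k / 2 * N)) * (Real.exp (l * ‖v x‖) + Real.exp (l * ‖w x‖)) with hgdef
  have hi1 : Integrable (fun x => N ^ 2 * ‖(v - w) x‖ ^ 2) mu := (integrable_norm_sq _).const_mul _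
  have hi2 : Integrable (fun x => 24 / (k / 2) ^ 4 * Real.exp (-(k / 2 * N)) *
      (Real.exp (l * ‖v x‖) + Real.exp (l * ‖w x‖))) mu := (hv.add hw).const_mul _
  have h1 : ‖a - b‖ ^ 2 ≤ ∫ x, g x ∂mu := by
    refine norm_sq_le_integral (hi1.add hi2) ?_
    filter_upwards [hab, Lp.coeFn_sub a b, Lp.coeFn_sub v w] with x hx h1 h2
    rw [h1, Pi.sub_apply]
    have h3 := sq_mul_sq_le (N := N) (norm_nonneg (v x - w x)) (norm_sub_le (v x) (w x)) hk0
    have h4 : Real.exp (k * (‖v x‖ + ‖w x‖)) ≤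
        Real.exp (l * ‖v x‖) + Real.exp (l * ‖w x‖) := by
      rcases le_total ‖v x‖ ‖w x‖ with h | h
      · have : Real.exp (k * (‖v x‖ + ‖w x‖)) ≤ Real.exp (l * ‖w x‖) :=
          Real.exp_le_exp.2 (by rw [hk]; nlinarith)
        linarith [Real.exp_pos (l * ‖v x‖)]
      · have : Real.exp (k * (‖v x‖ + ‖w x‖)) ≤ Real.exp (l * ‖v x‖) :=
          Real.exp_le_exp.2 (by rw [hk]; nlinarith)
        linarith [Real.exp_pos (l * ‖w x‖)]
    calc ‖a x - b x‖ ^ 2 ≤ (‖v x - w x‖ * (‖v x‖ + ‖w x‖)) ^ 2 := by gcongr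
      _ = ‖v x - w x‖ ^ 2 * (‖v x‖ + ‖w x‖) ^ 2 := by ring
      _ ≤ _ := h3
      _ ≤ _ := by
        rw [hgdef]
        simp only
        rw [h2, Pi.sub_apply]
        gcongr
  have h2 : ∫ x, g x ∂mu ≤ N ^ 2 * ‖v - w‖ ^ 2 +
      24 / (k / 2) ^ 4 * Real.exp (-(k / 2 * N)) * (2 * M) := by
    rw [hgdef, integral_add hi1 hi2, integral_const_mul, integral_const_mul, integral_add hv hw,
      ← norm_sq_eq_integral]
    gcongr
    linarith
  set S := √(24 / (k / 2) ^ 4 * (2 * M)) with hS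
  have hSS : S ^ 2 = 24 / (k / 2) ^ 4 * (2 * M) := Real.sq_sqrt (by positivity)
  have hS0 : 0 ≤ S := Real.sqrt_nonneg _
  have hexp : Real.exp (-(k / 2 / 2 * N)) ^ 2 = Real.exp (-(k / 2 * N)) := by
    rw [← Real.exp_nat_mul]; congr 1; push_cast; ring
  refine abs_le_of_sq_le_sq' (h1.trans (h2.trans ?_)) (by positivity) |>.2
  have h3 : 24 / (k / 2) ^ 4 * Real.exp (-(k / 2 * N)) * (2 * M) =
      (S * Real.exp (-(k / 2 / 2 * N))) ^ 2 := by
    rw [mul_pow, hSS, hexp]; ring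
  rw [h3]
  have : 0 ≤ N * ‖v - w‖ * (S * Real.exp (-(k / 2 / 2 * N))) := by positivity
  nlinarith

theorem J_eq_inner {v p : L2} (hp : ∀ᵐ x ∂mu, p x = (‖v x‖ : ℂ) ^ 2) : J v = inner ℂ p v := by
  rw [J, L2.inner_def]
  refine integral_congr_ae ?_
  filter_upwards [hp] with x hx
  rw [hx, RCLike.inner_apply, map_pow, Complex.conj_ofReal, mul_comm]

theorem norm_szego_le (v : L2) : ‖szego v‖ ≤ ‖v‖ := by
  have : hardySpace.HasOrthogonalProjection := by unfold hardySpace; infer_instance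
  exact hardySpace.norm_starProjection_apply_le v

/-- Writing `J v` as the inner product of `p` and `v` makes the vector field multilinear in `p`,
`q`, `v` and their conjugates, so its increments telescope. -/
theorem norm_vectorField_sub_le {v w p q p' q' : L2} {B Q E : ℝ}
    (hp : ∀ᵐ x ∂mu, p x = (‖v x‖ : ℂ) ^ 2) (hp' : ∀ᵐ x ∂mu, p' x = (‖w x‖ : ℂ) ^ 2)
    (hv : ‖v‖ ≤ B) (hw : ‖w‖ ≤ B) (hpQ : ‖p‖ ≤ Q) (hqQ : ‖q‖ ≤ Q) (hpQ' : ‖p'‖ ≤ Q)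
    (hpE : ‖p - p'‖ ≤ E) (hqE : ‖q - q'‖ ≤ E) :
    ‖((2 * J v) • szego p + conj (J v) • q) - ((2 * J w) • szego p' + conj (J w) • q')‖ ≤
      6 * Q * B * E + 3 * Q ^ 2 * ‖v - w‖ := by
  have hB : 0 ≤ B := (norm_nonneg _).trans hv
  have hQ : 0 ≤ Q := (norm_nonneg _).trans hpQ
  have hE : 0 ≤ E := (norm_nonneg _).trans hpE
  have hJw : ‖J w‖ ≤ Q * B := by
    rw [J_eq_inner hp']
    exact (norm_inner_le_norm _ _).trans (by gcongr)
  have hJ : ‖J v - J w‖ ≤ E * B + Q * ‖v - w‖ := by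
    have : J v - J w = inner ℂ (p - p') v + inner ℂ p' (v - w) := by
      rw [J_eq_inner hp, J_eq_inner hp', inner_sub_left, inner_sub_right]; ring
    rw [this]
    refine (norm_add_le _ _).trans (add_le_add ?_ ?_)
    · exact (norm_inner_le_norm _ _).trans (by gcongr)
    · exact (norm_inner_le_norm _ _).trans (by gcongr)
  have hsplit : ((2 * J v) • szego p + conj (J v) • q) -
      ((2 * J w) • szego p' + conj (J w) • q') =
      (2 * (J v - J w)) • szego p + (2 * J w) • szego (p - p') +
        (conj (J v - J w) • q + conj (J w) • (q - q')) := by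
    rw [map_sub szego, map_sub]
    module
  rw [hsplit]
  have hJ0 : 0 ≤ E * B + Q * ‖v - w‖ := by positivity
  have t1 : ‖(2 * (J v - J w)) • szego p‖ ≤ 2 * (E * B + Q * ‖v - w‖) * Q := by
    rw [norm_smul, norm_mul, Complex.norm_ofNat]
    have := (norm_szego_le p).trans hpQ
    gcongr
  have t2 : ‖(2 * J w) • szego (p - p')‖ ≤ 2 * (Q * B) * E := by
    rw [norm_smul, norm_mul, Complex.norm_ofNat]
    have := (norm_szego_le (p - p')).trans hpE
    gcongr
  have t3 : ‖conj (J v - J w) • q‖ ≤ (E * B + Q * ‖v - w‖) * Q := by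
    rw [norm_smul, RCLike.norm_conj]; gcongr
  have t4 : ‖conj (J w) • (q - q')‖ ≤ Q * B * E := by
    rw [norm_smul, RCLike.norm_conj]; gcongr
  have := norm_add₄_le (a := (2 * (J v - J w)) • szego p) (b := (2 * J w) • szego (p - p'))
    (c := conj (J v - J w) • q) (d := conj (J w) • (q - q'))
  rw [add_assoc _ _ (conj (J w) • (q - q'))] at this
  linarith

/-- Gronwall with rate `AN` gives `‖d t‖ ≤ (A'/A) exp(-N(c - A(t - s)))`, which tends to zero with
`N` as long as `A(t - s) < c`. -/
theorem eq_zero_of_norm_deriv_le {E : Type*} [NormedAddCommGroup E] [NormedSpace ℝ E]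
    {d d' : ℝ → E} {s r A A' c : ℝ} (hA : 0 < A) (hA' : 0 ≤ A')
    (hd : ∀ t, |t - s| ≤ r → HasDerivAt d (d' t) t) (h0 : d s = 0)
    (hb : ∀ t, |t - s| ≤ r → ∀ N : ℕ, 1 ≤ N →
      ‖d' t‖ ≤ A * N * ‖d t‖ + A' * Real.exp (-(c * N)))
    {t : ℝ} (hst : s ≤ t) (htr : t - s ≤ r) (htc : A * (t - s) < c) : d t = 0 := by
  have hin : ∀ x ∈ Icc s t, |x - s| ≤ r := fun x hx => by
    rw [abs_of_nonneg (by linarith [hx.1])]; linarith [hx.2]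
  have key : ∀ N : ℕ, 1 ≤ N → ‖d t‖ ≤ A' / A * Real.exp (-(c - A * (t - s))) ^ N := by
    intro N hN
    have hN' : (1 : ℝ) ≤ N := by exact_mod_cast hN
    have hK : 0 < A * N := by positivity
    have h := norm_le_gronwallBound_of_norm_deriv_right_le (f := d) (f' := d') (δ := 0)
      (fun x hx => (hd x (hin x hx)).continuousAt.continuousWithinAt)
      (fun x hx => (hd x (hin x ⟨hx.1, hx.2.le⟩)).hasDerivWithinAt) (by rw [h0, norm_zero])
      (fun x hx => hb x (hin x ⟨hx.1, hx.2.le⟩) N hN) t ⟨hst, le_rfl⟩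
    simp only [gronwallBound_of_K_ne_0 hK.ne', zero_mul, zero_add] at h
    refine h.trans ?_
    calc A' * Real.exp (-(c * N)) / (A * N) * (Real.exp (A * N * (t - s)) - 1)
        ≤ A' * Real.exp (-(c * N)) / A * Real.exp (A * N * (t - s)) := by
          have h1 : 0 ≤ Real.exp (A * N * (t - s)) - 1 := by
            rw [sub_nonneg]
            exact Real.one_le_exp (mul_nonneg hK.le (sub_nonneg.2 hst))
          gcongr
          · exact le_mul_of_one_le_right hA.le hN'
          · linarith
      _ = A' / A * Real.exp (-(c - A * (t - s))) ^ N := by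
          rw [← Real.exp_nat_mul, div_mul_eq_mul_div, div_mul_eq_mul_div, mul_assoc, ← Real.exp_add]
          congr 3
          ring
  have hlim : Tendsto (fun N : ℕ => A' / A * Real.exp (-(c - A * (t - s))) ^ N) atTop
      (𝓝 (A' / A * 0)) := by
    refine (tendsto_pow_atTop_nhds_zero_of_lt_one (Real.exp_pos _).le ?_).const_mul _
    rw [Real.exp_lt_one_iff]
    linarith
  rw [mul_zero] at hlim
  exact norm_le_zero_iff.1 (ge_of_tendsto hlim (eventually_atTop.2 ⟨1, key⟩))

theorem eventually_eq_zero_of_norm_deriv_le {E : Type*} [NormedAddCommGroup E] [NormedSpace ℝ E]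
    {d d' : ℝ → E} {s r A A' c : ℝ} (hr : 0 < r) (hA : 0 < A) (hA' : 0 ≤ A') (hc : 0 < c)
    (hd : ∀ t, |t - s| ≤ r → HasDerivAt d (d' t) t) (h0 : d s = 0)
    (hb : ∀ t, |t - s| ≤ r → ∀ N : ℕ, 1 ≤ N →
      ‖d' t‖ ≤ A * N * ‖d t‖ + A' * Real.exp (-(c * N))) : ∀ᶠ t in 𝓝 s, d t = 0 := by
  have hpos : 0 < min r (c / A) := lt_min hr (by positivity)
  filter_upwards [Metric.ball_mem_nhds s hpos] with t ht
  rw [Metric.mem_ball, Real.dist_eq, lt_min_iff, lt_div_iff₀ hA] at ht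
  rcases le_total s t with h | h
  · rw [abs_of_nonneg (sub_nonneg.2 h)] at ht
    exact eq_zero_of_norm_deriv_le hA hA' hd h0 hb h ht.1.le (by linarith [ht.2])
  · rw [abs_of_nonpos (sub_nonpos.2 h)] at ht
    -- Times before `s` are reached by reflecting about `s`.
    have habs : ∀ x, |x - s| ≤ r → |2 * s - x - s| ≤ r := fun x hx => by
      rwa [show 2 * s - x - s = -(x - s) by ring, abs_neg]
    have := eq_zero_of_norm_deriv_le (d := fun x => d (2 * s - x)) (d' := fun x => -d' (2 * s - x))
      (t := 2 * s - t) hA hA' (fun x hx => (hd _ (habs x hx)).comp_const_sub (2 * s) x)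
      (by rwa [show 2 * s - s = s by ring])
      (fun x hx N hN => by rw [norm_neg]; exact hb _ (habs x hx) N hN)
      (by linarith) (by linarith [ht.1]) (by linarith [ht.2])
    simpa using this

theorem IsSolution.continuous {u : ℝ → L2} (hu : IsSolution u) : Continuous u :=
  continuous_iff_continuousAt.2 fun t => by
    obtain ⟨_, _, _, _, _, h, _⟩ := hu.equation t
    exact h.continuousAt

theorem norm_normSq_sub_le (a b : ℂ) :
    ‖(‖a‖ : ℂ) ^ 2 - (‖b‖ : ℂ) ^ 2‖ ≤ ‖a - b‖ * (‖a‖ + ‖b‖) := by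
  have : (‖a‖ : ℂ) ^ 2 - (‖b‖ : ℂ) ^ 2 = (((‖a‖ - ‖b‖) * (‖a‖ + ‖b‖) : ℝ) : ℂ) := by
    push_cast; ring
  rw [this, Complex.norm_real, norm_mul, Real.norm_eq_abs,
    Real.norm_of_nonneg (add_nonneg (norm_nonneg a) (norm_nonneg b))]
  gcongr
  exact abs_norm_sub_norm_le a b

theorem norm_sq_sub_sq_le (a b : ℂ) : ‖a ^ 2 - b ^ 2‖ ≤ ‖a - b‖ * (‖a‖ + ‖b‖) := by
  rw [sq_sub_sq, norm_mul, mul_comm]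
  gcongr
  exact norm_add_le a b

theorem IsSolution.eventually_eq {u w : ℝ → L2} (hu : IsSolution u) (hw : IsSolution w) {s : ℝ}
    (hs : u s = w s) : ∀ᶠ t in 𝓝 s, u t = w t := by
  obtain ⟨C₁, hC₁⟩ := hu.locally_bounded (|s| + 1)
  obtain ⟨C₂, hC₂⟩ := hw.locally_bounded (|s| + 1)
  -- The `1` keeps `C` positive, as the rate `1/(10C)` requires. All constants below are uniform for
  -- times within `1` of `s`.
  set C := max (max C₁ C₂) 1 with hC
  have hC0 : 0 < C := lt_of_lt_of_le one_pos (le_max_right _ _)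
  obtain ⟨B₁, hB₁⟩ := (isCompact_Icc (a := -(|s| + 1)) (b := |s| + 1)).exists_bound_of_continuousOn
    hu.continuous.continuousOn
  obtain ⟨B₂, hB₂⟩ := (isCompact_Icc (a := -(|s| + 1)) (b := |s| + 1)).exists_bound_of_continuousOn
    hw.continuous.continuousOn
  set B := max B₁ B₂ with hB
  set l := 1 / (10 * C) with hl
  have hl0 : 0 < l := by positivity
  set M := 4 * Real.exp (l * ((1 + B ^ 2) / 2)) with hM
  set Q := √(24 / l ^ 4 * M) with hQ
  have hQ0 : 0 ≤ Q := Real.sqrt_nonneg _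
  set S := √(24 / (l / 4) ^ 4 * (2 * M)) with hS
  have hS0 : 0 ≤ S := Real.sqrt_nonneg _
  choose p q u' hp hq hud hueq using hu.equation
  choose p' q' w' hp' hq' hwd hweq using hw.equation
  have htR : ∀ t, |t - s| ≤ 1 → |t| ≤ |s| + 1 := fun t ht => by
    have := abs_sub_abs_le_abs_sub t s
    linarith
  have hB0 : 0 ≤ B := by
    have := hB₁ s ⟨by linarith [neg_abs_le s], by linarith [le_abs_self s]⟩
    exact (norm_nonneg _).trans (this.trans (le_max_left _ _))
  -- Since `N ≥ 1`, the genuinely Lipschitz term `3Q²‖u - w‖` is absorbed into the term linear in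
  -- `N`; the `+ 1` makes the coefficient positive.
  have key : ∀ t, |t - s| ≤ 1 → ∀ N : ℕ, 1 ≤ N → ‖u' t - w' t‖ ≤
      (6 * Q * B + 3 * Q ^ 2 + 1) * N * ‖u t - w t‖ +
        6 * Q * B * S * Real.exp (-(l / 8 * N)) := by
    intro t ht N hN
    have hN' : (1 : ℝ) ≤ N := by exact_mod_cast hN
    have htR' := htR t ht
    have hut : ‖u t‖ ≤ B := (hB₁ t (abs_le.1 htR')).trans (le_max_left _ _)
    have hwt : ‖w t‖ ≤ B := (hB₂ t (abs_le.1 htR')).trans (le_max_right _ _)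
    obtain ⟨iu, hMu⟩ := integrable_exp_norm hC0
      ((hC₁ t htR').mono ((le_max_left _ _).trans (le_max_left _ _))) hut
    obtain ⟨iw, hMw⟩ := integrable_exp_norm hC0
      ((hC₂ t htR').mono ((le_max_right _ _).trans (le_max_left _ _))) hwt
    have np : ‖p t‖ ≤ Q := norm_le_of_pow_four hl0 iu hMu
      ((hp t).mono fun x hx => by rw [hx, norm_pow, Complex.norm_real, norm_norm])
    have nq : ‖q t‖ ≤ Q := norm_le_of_pow_four hl0 iu hMu
      ((hq t).mono fun x hx => by rw [hx, norm_pow])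
    have np' : ‖p' t‖ ≤ Q := norm_le_of_pow_four hl0 iw hMw
      ((hp' t).mono fun x hx => by rw [hx, norm_pow, Complex.norm_real, norm_norm])
    have dp := norm_sub_le_of_exp (a := p t) (b := p' t) hl0 iu hMu iw hMw
      (by filter_upwards [hp t, hp' t] with x h1 h2
          rw [h1, h2]; exact norm_normSq_sub_le _ _) (N := N) (by linarith)
    have dq := norm_sub_le_of_exp (a := q t) (b := q' t) hl0 iu hMu iw hMw
      (by filter_upwards [hq t, hq' t] with x h1 h2
          rw [h1, h2]; exact norm_sq_sub_sq_le _ _) (N := N) (by linarith)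
    have hV := norm_vectorField_sub_le (hp t) (hp' t) hut hwt np nq np' dp dq
    rw [← hueq, ← hweq, ← smul_sub, norm_smul, Complex.norm_I, one_mul] at hV
    refine hV.trans ?_
    have e1 : 3 * Q ^ 2 * ‖u t - w t‖ ≤ 3 * Q ^ 2 * ‖u t - w t‖ * N :=
      le_mul_of_one_le_right (by positivity) hN'
    have e2 : 0 ≤ N * ‖u t - w t‖ := by positivity
    nlinarith
  have hev := eventually_eq_zero_of_norm_deriv_le (d := fun t => u t - w t)
    (d' := fun t => u' t - w' t) one_pos (by positivity) (by positivity)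
    (show 0 < l / 8 by positivity) (fun t _ => (hud t).sub (hwd t)) (sub_eq_zero.2 hs) key
  exact hev.mono fun t ht => sub_eq_zero.1 ht

/-- Solutions in `BMO₊` are determined by their initial datum. -/
theorem IsSolution.unique {u w : ℝ → L2} (hu : IsSolution u) (hw : IsSolution w)
    (h0 : u 0 = w 0) : u = w := by
  -- Closed by continuity, open by local uniqueness, and nonempty because it contains `0`.
  have hclopen : IsClopen {t | u t = w t} :=
    ⟨isClosed_eq hu.continuous hw.continuous,
      isOpen_iff_mem_nhds.2 fun s hs => hu.eventually_eq hw hs⟩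
  have := hclopen.eq_univ ⟨0, h0⟩
  exact funext fun t => this.ge (mem_univ t)

end Uniqueness

end QuadSzego

end

theorem proposition3 (f : QuadSzego.L2) (hf : QuadSzego.IsInner f)
    (u₀ : QuadSzego.L2) (hu₀ : u₀ ∈ QuadSzego.BMOplus)
    (u : ℝ → QuadSzego.L2) (hu : QuadSzego.IsSolution u) (hu_init : u 0 = u₀) :
    (∀ z ∈ Metric.ball (0 : ℂ) 1, z * QuadSzego.discFun f z ∈ Metric.ball (0 : ℂ) 1) ∧
    ∃ (v₀ : QuadSzego.L2) (v : ℝ → QuadSzego.L2),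
      v₀ ∈ QuadSzego.BMOplus ∧
      (∀ z ∈ Metric.ball (0 : ℂ) 1,
        QuadSzego.discFun v₀ z = QuadSzego.discFun u₀ (z * QuadSzego.discFun f z)) ∧
      (∀ t : ℝ, ∀ z ∈ Metric.ball (0 : ℂ) 1,
        QuadSzego.discFun (v t) z = QuadSzego.discFun (u t) (z * QuadSzego.discFun f z)) ∧
      QuadSzego.IsSolution v ∧ v 0 = v₀ ∧
      ∀ w : ℝ → QuadSzego.L2, QuadSzego.IsSolution w → w 0 = v₀ → w = v := by
  simp only [mem_ball_zero_iff]
  refine ⟨fun z hz => hf.norm_mul_discFun_lt hz, QuadSzego.compInner hf u₀,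
    fun t => QuadSzego.compInner hf (u t), QuadSzego.compInner_mem_BMOplus hf hu₀,
    fun z hz => QuadSzego.discFun_compInner hf hu₀.1 hz,
    fun t z hz => QuadSzego.discFun_compInner hf (hu.mem_BMOplus t).1 hz,
    hu.compInner hf, congrArg _ hu_init, fun w hw hw0 => hw.unique (hu.compInner hf) ?_⟩
  exact hw0.trans (congrArg _ hu_init.symm)
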